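/- Let $d\ge 2$ and $0<\alpha\le\beta<\infty$. Let $\mathcal M_{\alpha\beta}$ be the set of real $d\times d$ matrices $M$ with $v\cdot Mv\ge\alpha|v|^2$ and $|Mv|\le\beta|v|$ for all $v\in\mathbb R^d$, and let $L^\infty(\mathbb R^d,\mathcal M_{\alpha\beta})$ be the set of measurable fields of $d\times d$ matrices on $\mathbb R^d$ with values in $\mathcal M_{\alpha\beta}$ almost everywhere. For $r>0$ set $Q_r:=(-r,r)^d$. For $A\in L^\infty(\mathbb R^d,\mathcal M_{\alpha\beta})$, a unit vector $\xi\in\mathbb R^d$ and $T>0$, let the regularized corrector $\phi_T\in H^1_{\mathrm{loc}}(\mathbb R^d)$ be the distributional solution of $$T^{-1}\phi_T-\nabla\cdot A(\xi+\nabla\phi_T)=0\quad\text{in }\mathbb R^d$$ in the class of functions $v\in H^1_{\mathrm{loc}}(\mathbb R^d)$ with $\sup_{x\in\mathbb R^d}\int_{B_1(x)}(v^2+|\nabla v|^2)<\infty$. For $R>0$ let $\phi_{T,R}\in H^1_0(Q_R)$ be the weak solution of $$\int_{Q_R}T^{-1}\psi\,\phi_{T,R}+\nabla\psi\cdot A(\xi+\nabla\phi_{T,R})=0\qquad\text{for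 all }\psi\in H^1_0(Q_R).$$ Then there exists $c>0$ depending only on $\alpha,\beta$ and $d$ such that the following holds. For all $T_0,K_1,K_2>0$ there is a constant $C>0$, depending only on $d,\alpha,\beta,T_0,K_1,K_2$, such that for every $A\in L^\infty(\mathbb R^d,\mathcal M_{\alpha\beta})$, every unit vector $\xi\in\mathbb R^d$, every $T\ge T_0$ and all $0<L\le R$ with $R\le K_1(R-L)$ and $\sqrt T\le K_2(R-L)$ (that is, $T\gtrsim 1$ and $R\sim R-L\gtrsim\sqrt T$), $$\int_{Q_L}|\nabla\phi_{T,R}-\nabla\phi_T|^2\;\le\; C\,R^d\,T\exp\Big(-c\,\frac{R-L}{\sqrt T}\Big).$$ -/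

import Mathlib

open MeasureTheory Filter
open scoped Topology ContDiff

/-- The open cube `(-R, R)^d`. -/
def cube (d : ℕ) (R : ℝ) : Set (EuclideanSpace ℝ (Fin d)) :=
  {x | ∀ i, -R < x i ∧ x i < R}

/-- The set of real `d × d` matrices `M` with `ξ · Mξ ≥ α|ξ|²` and `|Mξ| ≤ β|ξ|` for all `ξ`
(Euclidean norm). -/
def ellipticMatrices (d : ℕ) (α β : ℝ) : Set (Matrix (Fin d) (Fin d) ℝ) :=
  {M | ∀ v : EuclideanSpace ℝ (Fin d),
    α * ‖v‖ ^ 2 ≤ inner ℝ v (Matrix.toEuclideanLin M v) ∧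
      ‖Matrix.toEuclideanLin M v‖ ≤ β * ‖v‖}

/-- `A ∈ L^∞(ℝ^d, M_{αβ})`: `A` is (Lebesgue) measurable and takes its values in `M_{αβ}`
almost everywhere. -/
def IsCoefficientField {d : ℕ} (α β : ℝ)
    (A : EuclideanSpace ℝ (Fin d) → Matrix (Fin d) (Fin d) ℝ) : Prop :=
  (∀ i j, AEMeasurable (fun x => A x i j) volume) ∧
    ∀ᵐ x ∂volume, A x ∈ ellipticMatrices d α β

/-- `ψ ∈ C_c^∞(U)`, as a function on the whole space. -/
def IsTestFunction {d : ℕ} (U : Set (EuclideanSpace ℝ (Fin d)))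
    (ψ : EuclideanSpace ℝ (Fin d) → ℝ) : Prop :=
  ContDiff ℝ ∞ ψ ∧ HasCompactSupport ψ ∧ tsupport ψ ⊆ U

/-- `G` is the weak (distributional) gradient of `u` on the open set `U`. -/
def HasWeakGradient {d : ℕ} (U : Set (EuclideanSpace ℝ (Fin d)))
    (u : EuclideanSpace ℝ (Fin d) → ℝ)
    (G : EuclideanSpace ℝ (Fin d) → EuclideanSpace ℝ (Fin d)) : Prop :=
  LocallyIntegrableOn u U volume ∧ LocallyIntegrableOn G U volume ∧
    ∀ ψ : EuclideanSpace ℝ (Fin d) → ℝ, IsTestFunction U ψ → ∀ i : Fin d,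
      ∫ x in U, u x * gradient ψ x i = -∫ x in U, G x i * ψ x

/-- `u ∈ H¹(U)` with weak gradient `G`. -/
def MemH1 {d : ℕ} (U : Set (EuclideanSpace ℝ (Fin d)))
    (u : EuclideanSpace ℝ (Fin d) → ℝ)
    (G : EuclideanSpace ℝ (Fin d) → EuclideanSpace ℝ (Fin d)) : Prop :=
  MemLp u 2 (volume.restrict U) ∧ MemLp G 2 (volume.restrict U) ∧ HasWeakGradient U u G

/-- `u ∈ H¹₀(U)`, the closure of `C_c^∞(U)` in `H¹(U)`, with weak gradient `G`. -/
def MemH10 {d : ℕ} (U : Set (EuclideanSpace ℝ (Fin d)))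
    (u : EuclideanSpace ℝ (Fin d) → ℝ)
    (G : EuclideanSpace ℝ (Fin d) → EuclideanSpace ℝ (Fin d)) : Prop :=
  MemH1 U u G ∧
    ∃ ψ : ℕ → EuclideanSpace ℝ (Fin d) → ℝ, (∀ n, IsTestFunction U (ψ n)) ∧
      Tendsto (fun n => eLpNorm (fun x => ψ n x - u x) 2 (volume.restrict U)) atTop (𝓝 0) ∧
      Tendsto (fun n => eLpNorm (fun x => gradient (ψ n) x - G x) 2 (volume.restrict U))
        atTop (𝓝 0)

/-- `u ∈ H¹_loc(ℝ^d)` with weak gradient `G`. -/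
def MemH1Loc {d : ℕ} (u : EuclideanSpace ℝ (Fin d) → ℝ)
    (G : EuclideanSpace ℝ (Fin d) → EuclideanSpace ℝ (Fin d)) : Prop :=
  (∀ K : Set (EuclideanSpace ℝ (Fin d)), IsCompact K →
    MemLp u 2 (volume.restrict K) ∧ MemLp G 2 (volume.restrict K)) ∧
    HasWeakGradient Set.univ u G

/-- `φ` (with weak gradient `G`) is the regularized corrector `φ_T` in direction `ξ`: it lies in
`H¹_loc(ℝ^d)`, it is uniformly locally bounded in `H¹`, and it is a distributional solution of
`T⁻¹ φ - ∇ · A (ξ + ∇φ) = 0` in `ℝ^d`. -/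
structure IsRegularizedCorrector {d : ℕ}
    (A : EuclideanSpace ℝ (Fin d) → Matrix (Fin d) (Fin d) ℝ)
    (ξ : EuclideanSpace ℝ (Fin d)) (T : ℝ)
    (φ : EuclideanSpace ℝ (Fin d) → ℝ)
    (G : EuclideanSpace ℝ (Fin d) → EuclideanSpace ℝ (Fin d)) : Prop where
  memH1Loc : MemH1Loc φ G
  unif_bound : BddAbove (Set.range fun x : EuclideanSpace ℝ (Fin d) =>
    ∫ y in Metric.ball x 1, (φ y ^ 2 + ‖G y‖ ^ 2))
  equation : ∀ ψ : EuclideanSpace ℝ (Fin d) → ℝ, IsTestFunction Set.univ ψ →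
    ∫ x, (T⁻¹ * ψ x * φ x +
      inner ℝ (gradient ψ x) (Matrix.toEuclideanLin (A x) (ξ + G x))) = 0

/-- `φ` (with weak gradient `G`) is the Dirichlet approximation `φ_{T,R}`: the weak solution in
`H¹₀(Q_R)` of `T⁻¹ φ - ∇ · A (ξ + ∇φ) = 0` in the cube `Q_R = (-R, R)^d`. -/
structure IsDirichletCorrector {d : ℕ}
    (A : EuclideanSpace ℝ (Fin d) → Matrix (Fin d) (Fin d) ℝ)
    (ξ : EuclideanSpace ℝ (Fin d)) (T R : ℝ)
    (φ : EuclideanSpace ℝ (Fin d) → ℝ)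
    (G : EuclideanSpace ℝ (Fin d) → EuclideanSpace ℝ (Fin d)) : Prop where
  memH10 : MemH10 (cube d R) φ G
  equation : ∀ (ψ : EuclideanSpace ℝ (Fin d) → ℝ)
    (Dψ : EuclideanSpace ℝ (Fin d) → EuclideanSpace ℝ (Fin d)), MemH10 (cube d R) ψ Dψ →
    ∫ x in cube d R, (T⁻¹ * ψ x * φ x +
      inner ℝ (Dψ x) (Matrix.toEuclideanLin (A x) (ξ + G x))) = 0

/-! The difference `w` of the two correctors solves the massive equation on the cube `Q_R` with no
source term, since both equations carry the same `ξ`. The mass `T⁻¹` forces such solutions to decay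
away from the boundary on the length scale `√T`. To see this, test with `η² w`, where `η` is a
cutoff that behaves like `1 / ∑ cosh (μ xᵢ)` and satisfies `|∇η| ≤ 2μ (η + 2 / cosh (μR))`. With `μ`
a suitable multiple of `1 / √T`, the part of the cutoff error proportional to `μη` is absorbed
exactly by the mass term. What remains is `cosh (μR)⁻²` times the energy of `w` on `Q_R`. Since `η`
is at least of order `1 / cosh (μL)` on `Q_L`, the quotient gives `exp (-2μ (R - L))`; this is
`setIntegral_cube_norm_sq_le_exp`.

The energy of `w` on `Q_R` is of order `R^d`. For the Dirichlet corrector this follows by testing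
with the corrector itself (`IsDirichletCorrector.energy_le`). For the whole-space corrector
(`exists_corrector_energy_bound`), `caccioppoli` bounds the energy on a ball of radius `r ≳ √T` by a
small multiple of the energy on the doubled ball plus `C r^d`. The uniform local bound, which is
purely qualitative, only supplies polynomial growth, and iteration removes its size from the
estimate.

The distributional equation admits smooth test functions only. `weak_equation_mul_testFunction`
extends it to a cutoff times the solution, by mollification and weak convergence in `L²`. -/

/-! ### Weak convergence of mollifications in `L²`. -/

section Mollification

variable {E : Type*} [NormedAddCommGroup E] [InnerProductSpace ℝ E] [FiniteDimensional ℝ E]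
  [MeasurableSpace E] [BorelSpace E]

theorem memLp_two_comp_add_right {v : E → ℝ} (hv : MemLp v 2 (volume : Measure E)) (s : E) :
    MemLp (fun x => v (x + s)) 2 (volume : Measure E) :=
  hv.comp_measurePreserving (measurePreserving_add_right volume s)

/-- The correlation of two square integrable functions is continuous. -/
theorem continuous_integral_mul_comp_add {f v : E → ℝ} (hf : MemLp f 2 (volume : Measure E))
    (hv : MemLp v 2 (volume : Measure E)) :
    Continuous fun s : E => ∫ x, f x * v (x + s) := by
  have : Fact ((2 : ENNReal) ≠ ⊤) := ⟨by simp⟩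
  -- Translations act strongly continuously on `L²`, so pairing a translate with a fixed function is
  -- continuous in the shift.
  have h : Continuous fun s : E =>
      inner ℝ (DomAddAct.mk s +ᵥ hv.toLp v) (hf.toLp f) := by
    refine Continuous.inner ?_ continuous_const
    have h1 : Continuous fun s : E => DomAddAct.mk s := DomAddAct.continuous_mk
    exact h1.vadd continuous_const
  refine h.congr fun s => ?_
  rw [L2.inner_def, DomAddAct.mk_vadd_toLp]
  refine integral_congr_ae ?_
  have hv' : MemLp (fun x => v (s +ᵥ x)) 2 (volume : Measure E) :=
    hv.comp_measurePreserving (measurePreserving_vadd s volume)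
  filter_upwards [hf.coeFn_toLp, hv'.coeFn_toLp] with x h1 h2
  rw [h1]
  have : (hv'.toLp _ : E → ℝ) x = v (s +ᵥ x) := h2
  rw [this]
  simp [vadd_eq_add, add_comm]

/-- Mollifications of a square integrable function converge weakly. -/
theorem tendsto_integral_mul_convolution {f v : E → ℝ} (hf : MemLp f 2 (volume : Measure E))
    (hv : MemLp v 2 (volume : Measure E)) (ρ : ℕ → ContDiffBump (0 : E))
    (hρ : Tendsto (fun n => (ρ n).rOut) atTop (𝓝 0)) :
    Tendsto (fun n => ∫ x, f x * convolution ((ρ n).normed volume) v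
      (ContinuousLinearMap.lsmul ℝ ℝ) volume x) atTop (𝓝 (∫ x, f x * v x)) := by
  have hcont := continuous_integral_mul_comp_add hf hv
  -- By Fubini, pairing `f` with the mollification of `v` is mollifying the correlation `s ↦ ∫ f v(·
  -- + s)` at `s = 0`, where it is continuous.
  have hlim := ContDiffBump.convolution_tendsto_right_of_continuous (μ := (volume : Measure E))
    hρ hcont 0
  simp only [add_zero] at hlim
  refine hlim.congr fun n => ?_
  -- Continuity for the absolute values provides the integrability that Fubini needs.
  have habs : Continuous fun s : E => ∫ x, |f x| * |v (x + s)| :=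
    continuous_integral_mul_comp_add hf.abs hv.abs
  have hint : Integrable (Function.uncurry fun (t x : E) =>
      (ρ n).normed volume t * (f x * v (x - t))) ((volume : Measure E).prod volume) := by
    have hm : AEStronglyMeasurable (Function.uncurry fun (t x : E) =>
      (ρ n).normed volume t * (f x * v (x - t))) ((volume : Measure E).prod volume) := by
      refine AEStronglyMeasurable.mul ?_ (AEStronglyMeasurable.mul ?_ ?_)
      · exact ((ρ n).continuous_normed (μ := volume)).aestronglyMeasurable.comp_fst
      · exact hf.1.comp_snd
      · have h2 : AEStronglyMeasurable (fun p : E × E => v (p.1 - p.2))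
            ((volume : Measure E).prod volume) :=
          hv.1.comp_quasiMeasurePreserving (quasiMeasurePreserving_sub volume volume)
        exact h2.comp_measurePreserving Measure.measurePreserving_swap
    rw [integrable_prod_iff hm]
    constructor
    · refine Eventually.of_forall fun t => ?_
      have h1 := (memLp_two_comp_add_right hv (-t))
      simp only [← sub_eq_add_neg] at h1
      have h2 := (hf.integrable_mul h1).const_mul ((ρ n).normed volume t)
      exact h2
    · have hc : Continuous fun t : E => |(ρ n).normed volume t| * ∫ x, |f x| * |v (x + -t)| :=
        ((ρ n).continuous_normed (μ := volume)).abs.mul (habs.comp continuous_neg)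
      have hs : HasCompactSupport fun t : E =>
          |(ρ n).normed volume t| * ∫ x, |f x| * |v (x + -t)| := by
        refine HasCompactSupport.mul_right ?_
        exact ((ρ n).hasCompactSupport_normed (μ := volume)).norm
      refine (hc.integrable_of_hasCompactSupport hs).congr (Eventually.of_forall fun t => ?_)
      simp only [Function.uncurry_apply_pair, norm_mul, Real.norm_eq_abs]
      rw [integral_const_mul]
      simp [sub_eq_add_neg]
  calc convolution ((ρ n).normed volume) (fun s => ∫ x, f x * v (x + s))
        (ContinuousLinearMap.lsmul ℝ ℝ) volume 0
      = ∫ t, ∫ x, (ρ n).normed volume t * (f x * v (x - t)) := by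
        simp only [convolution_def, ContinuousLinearMap.lsmul_apply, smul_eq_mul, zero_sub]
        refine integral_congr_ae (Eventually.of_forall fun t => ?_)
        simp only [integral_const_mul, sub_eq_add_neg]
    _ = ∫ x, ∫ t, (ρ n).normed volume t * (f x * v (x - t)) := integral_integral_swap hint
    _ = _ := by
        refine integral_congr_ae (Eventually.of_forall fun x => ?_)
        simp only [convolution_def, ContinuousLinearMap.lsmul_apply, smul_eq_mul,
          ← integral_const_mul]
        refine integral_congr_ae (Eventually.of_forall fun t => ?_)
        simp only []
        ring

end Mollification

/-! ### Gradients of products and of mollifications. -/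

section Gradient

variable {d : ℕ}

theorem gradient_apply_eq (ψ : EuclideanSpace ℝ (Fin d) → ℝ) (x : EuclideanSpace ℝ (Fin d))
    (i : Fin d) : gradient ψ x i = fderiv ℝ ψ x (EuclideanSpace.single i 1) := by
  rw [← inner_gradient_left, real_inner_comm, EuclideanSpace.inner_single_left]
  simp

theorem gradient_mul {f g : EuclideanSpace ℝ (Fin d) → ℝ} {x : EuclideanSpace ℝ (Fin d)}
    (hf : DifferentiableAt ℝ f x) (hg : DifferentiableAt ℝ g x) :
    gradient (fun y => f y * g y) x = f x • gradient g x + g x • gradient f x := by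
  ext i
  simp only [PiLp.add_apply, PiLp.smul_apply, gradient_apply_eq, smul_eq_mul]
  rw [fderiv_fun_mul hf hg]
  simp

theorem continuous_gradient {ψ : EuclideanSpace ℝ (Fin d) → ℝ} (hψ : ContDiff ℝ ∞ ψ) :
    Continuous (gradient ψ) := by
  have h := hψ.continuous_fderiv (by simp)
  exact (InnerProductSpace.toDual ℝ (EuclideanSpace ℝ (Fin d))).symm.continuous.comp h

theorem support_gradient_subset (ψ : EuclideanSpace ℝ (Fin d) → ℝ) :
    Function.support (gradient ψ) ⊆ tsupport ψ := by
  intro x hx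
  by_contra h
  apply hx
  have : fderiv ℝ ψ x = 0 := by
    by_contra h2
    exact h (support_fderiv_subset ℝ h2)
  simp [gradient, this]

theorem tsupport_gradient_subset (ψ : EuclideanSpace ℝ (Fin d) → ℝ) :
    tsupport (gradient ψ) ⊆ tsupport ψ :=
  closure_minimal (support_gradient_subset ψ) (isClosed_tsupport ψ)

/-- The gradient of a mollification is the mollification of the weak gradient. -/
theorem gradient_convolution_apply {v : EuclideanSpace ℝ (Fin d) → ℝ}
    {H : EuclideanSpace ℝ (Fin d) → EuclideanSpace ℝ (Fin d)}
    (hw : HasWeakGradient Set.univ v H) {ρ : EuclideanSpace ℝ (Fin d) → ℝ}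
    (hρ : ContDiff ℝ ∞ ρ) (hc : HasCompactSupport ρ) (x : EuclideanSpace ℝ (Fin d)) (i : Fin d) :
    gradient (convolution ρ v (ContinuousLinearMap.lsmul ℝ ℝ) volume) x i =
      convolution ρ (fun y => H y i) (ContinuousLinearMap.lsmul ℝ ℝ) volume x := by
  have hv : LocallyIntegrable v volume := locallyIntegrableOn_univ.1 hw.1
  have h1 := hc.hasFDerivAt_convolution_left (ContinuousLinearMap.lsmul ℝ ℝ)
    (hρ.of_le (by simp)) hv (μ := volume) x
  rw [gradient_apply_eq, h1.fderiv]
  have hcexist : ConvolutionExistsAt (fderiv ℝ ρ) v x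
      (ContinuousLinearMap.precompL (EuclideanSpace ℝ (Fin d)) (ContinuousLinearMap.lsmul ℝ ℝ))
      volume :=
    (hc.fderiv ℝ).convolutionExists_left _ (hρ.continuous_fderiv (by simp)) hv x
  rw [convolution_eq_swap, convolution_eq_swap,
    ContinuousLinearMap.integral_apply hcexist.integrable_swap]
  -- The reflected kernel is an admissible test function; the sign from the reflection cancels the
  -- one in the definition of the weak gradient.
  have htest : IsTestFunction Set.univ (fun y => ρ (x - y)) := by
    refine ⟨hρ.comp (contDiff_const.sub contDiff_id), ?_, Set.subset_univ _⟩
    exact hc.comp_homeomorph (Homeomorph.subLeft x)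
  have h2 := hw.2.2 _ htest i
  simp only [Measure.restrict_univ] at h2
  have h3 : ∀ y, gradient (fun y => ρ (x - y)) y i =
      - fderiv ℝ ρ (x - y) (EuclideanSpace.single i 1) := by
    intro y
    have h4 : HasFDerivAt (fun y => ρ (x - y)) ((fderiv ℝ ρ (x - y)).comp
        (-ContinuousLinearMap.id ℝ (EuclideanSpace ℝ (Fin d)))) y :=
      ((hρ.differentiable (by simp)).differentiableAt.hasFDerivAt).comp y
        ((hasFDerivAt_id y).const_sub x)
    rw [gradient_apply_eq, h4.fderiv]
    simp
  simp only [h3] at h2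
  simp only [mul_neg, integral_neg, neg_inj] at h2
  simp only [ContinuousLinearMap.precompL_apply, ContinuousLinearMap.lsmul_apply, smul_eq_mul]
  rw [← integral_congr_ae (Eventually.of_forall fun y => mul_comm (H y i) (ρ (x - y))), ← h2]
  exact integral_congr_ae (Eventually.of_forall fun y => mul_comm _ _)

end Gradient

/-! ### Localization, and testing with a cutoff times the solution. -/

section Extension

variable {d : ℕ} {F : Type*} [NormedAddCommGroup F]

/-- Square integrability on the compact subsets of `U`. -/
def MemL2Loc (U : Set (EuclideanSpace ℝ (Fin d))) (u : EuclideanSpace ℝ (Fin d) → F) : Prop :=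
  ∀ K : Set (EuclideanSpace ℝ (Fin d)), IsCompact K → K ⊆ U → MemLp u 2 (volume.restrict K)

variable {U : Set (EuclideanSpace ℝ (Fin d))}

theorem memL2Loc_of_memLp {u : EuclideanSpace ℝ (Fin d) → F} (hu : MemLp u 2 (volume.restrict U)) :
    MemL2Loc U u :=
  fun _ _ hK => hu.mono_measure (Measure.restrict_mono hK le_rfl)

theorem MemL2Loc.mono {V : Set (EuclideanSpace ℝ (Fin d))} {u : EuclideanSpace ℝ (Fin d) → F}
    (hu : MemL2Loc U u) (h : V ⊆ U) : MemL2Loc V u :=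
  fun K hK hKV => hu K hK (hKV.trans h)

theorem MemL2Loc.sub {u v : EuclideanSpace ℝ (Fin d) → F}
    (hu : MemL2Loc U u) (hv : MemL2Loc U v) : MemL2Loc U (fun x => u x - v x) :=
  fun K hK hKU => (hu K hK hKU).sub (hv K hK hKU)

theorem MemL2Loc.memLp_indicator {u : EuclideanSpace ℝ (Fin d) → F} (hu : MemL2Loc U u)
    {K : Set (EuclideanSpace ℝ (Fin d))} (hK : IsCompact K) (hKU : K ⊆ U) :
    MemLp (K.indicator u) 2 volume :=
  (memLp_indicator_iff_restrict hK.measurableSet).2 (hu K hK hKU)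

theorem MemL2Loc.smul_continuous [NormedSpace ℝ F] {u : EuclideanSpace ℝ (Fin d) → F} (hu : MemL2Loc U u)
    {g : EuclideanSpace ℝ (Fin d) → ℝ} (hg : Continuous g) (hc : HasCompactSupport g)
    (hs : tsupport g ⊆ U) : MemLp (fun x => g x • u x) 2 volume := by
  obtain ⟨C, hC⟩ := hg.bounded_above_of_compact_support hc
  have h := hu.memLp_indicator hc hs
  have heq : (fun x => g x • u x) = fun x => g x • (tsupport g).indicator u x := by
    ext x
    by_cases hx : x ∈ tsupport g
    · simp [hx]
    · simp [hx, image_eq_zero_of_notMem_tsupport hx]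
  rw [heq]
  refine h.of_le_mul (c := C) (hg.aestronglyMeasurable.smul h.1) (Eventually.of_forall fun x => ?_)
  rw [norm_smul]
  gcongr
  exact hC x

theorem MemL2Loc.continuous_smul [NormedSpace ℝ F] {u : EuclideanSpace ℝ (Fin d) → ℝ} (hu : MemL2Loc U u)
    {g : EuclideanSpace ℝ (Fin d) → F} (hg : Continuous g) (hc : HasCompactSupport g)
    (hs : tsupport g ⊆ U) : MemLp (fun x => u x • g x) 2 volume := by
  obtain ⟨C, hC⟩ := hg.bounded_above_of_compact_support hc
  have h := hu.memLp_indicator hc hs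
  have heq : (fun x => u x • g x) = fun x => (tsupport g).indicator u x • g x := by
    ext x
    by_cases hx : x ∈ tsupport g
    · simp [hx]
    · simp [hx, image_eq_zero_of_notMem_tsupport hx]
  rw [heq]
  refine h.of_le_mul (c := C) (h.1.smul hg.aestronglyMeasurable) (Eventually.of_forall fun x => ?_)
  rw [norm_smul, mul_comm]
  gcongr
  exact hC x

theorem MemL2Loc.integrable_mul_continuous {u g : EuclideanSpace ℝ (Fin d) → ℝ}
    (hu : MemL2Loc U u) (hg : Continuous g) (hc : HasCompactSupport g) (hs : tsupport g ⊆ U) :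
    Integrable (fun x => u x * g x) volume := by
  have h1 := hu.memLp_indicator hc hs
  have h2 : MemLp g 2 volume := hg.memLp_of_hasCompactSupport hc
  refine (h1.integrable_mul h2).congr (Eventually.of_forall fun x => ?_)
  by_cases hx : x ∈ tsupport g
  · simp [hx]
  · simp [hx, image_eq_zero_of_notMem_tsupport hx]

theorem MemL2Loc.apply {G : EuclideanSpace ℝ (Fin d) → EuclideanSpace ℝ (Fin d)}
    (hG : MemL2Loc U G) (i : Fin d) : MemL2Loc U (fun x => G x i) := by
  intro K hK hKU
  have h := hG K hK hKU
  refine h.of_le_mul (c := 1) ?_ (Eventually.of_forall fun x => ?_)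
  · exact (EuclideanSpace.proj (𝕜 := ℝ) i).continuous.comp_aestronglyMeasurable h.1
  · rw [one_mul]
    exact PiLp.norm_apply_le (G x) i

theorem IsTestFunction.mono {V : Set (EuclideanSpace ℝ (Fin d))}
    {ψ : EuclideanSpace ℝ (Fin d) → ℝ} (hψ : IsTestFunction U ψ) (h : U ⊆ V) :
    IsTestFunction V ψ :=
  ⟨hψ.1, hψ.2.1, hψ.2.2.trans h⟩

theorem IsTestFunction.mul {ζ ψ : EuclideanSpace ℝ (Fin d) → ℝ} (hζ : IsTestFunction U ζ)
    (hψ : ContDiff ℝ ∞ ψ) : IsTestFunction U (fun x => ζ x * ψ x) :=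
  ⟨hζ.1.mul hψ, hζ.2.1.mul_right, (tsupport_mul_subset_left).trans hζ.2.2⟩

theorem IsTestFunction.differentiableAt {ζ : EuclideanSpace ℝ (Fin d) → ℝ}
    (hζ : IsTestFunction U ζ) (x : EuclideanSpace ℝ (Fin d)) : DifferentiableAt ℝ ζ x :=
  (hζ.1.differentiable (by simp)).differentiableAt

theorem IsTestFunction.hasCompactSupport_gradient {ζ : EuclideanSpace ℝ (Fin d) → ℝ}
    (hζ : IsTestFunction U ζ) : HasCompactSupport (gradient ζ) :=
  hζ.2.1.of_isClosed_subset (isClosed_tsupport _) (tsupport_gradient_subset ζ)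

theorem IsTestFunction.tsupport_gradient {ζ : EuclideanSpace ℝ (Fin d) → ℝ}
    (hζ : IsTestFunction U ζ) : tsupport (gradient ζ) ⊆ U :=
  (tsupport_gradient_subset ζ).trans hζ.2.2

theorem IsTestFunction.eq_zero {ζ : EuclideanSpace ℝ (Fin d) → ℝ}
    (hζ : IsTestFunction U ζ) {x : EuclideanSpace ℝ (Fin d)} (hx : x ∉ U) : ζ x = 0 :=
  image_eq_zero_of_notMem_tsupport fun h => hx (hζ.2.2 h)

theorem IsTestFunction.gradient_eq_zero {ζ : EuclideanSpace ℝ (Fin d) → ℝ}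
    (hζ : IsTestFunction U ζ) {x : EuclideanSpace ℝ (Fin d)} (hx : x ∉ U) : gradient ζ x = 0 :=
  image_eq_zero_of_notMem_tsupport fun h => hx (hζ.tsupport_gradient h)

variable {u : EuclideanSpace ℝ (Fin d) → ℝ}
  {G : EuclideanSpace ℝ (Fin d) → EuclideanSpace ℝ (Fin d)}

theorem MemL2Loc.integrable_mul_gradient_apply {ψ : EuclideanSpace ℝ (Fin d) → ℝ}
    (hu : MemL2Loc U u) (hψ : IsTestFunction U ψ) (i : Fin d) :
    Integrable (fun x => u x * gradient ψ x i) volume := by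
  have hsub : tsupport (fun x => gradient ψ x i) ⊆ tsupport (gradient ψ) := by
    refine closure_mono fun x hx => ?_
    intro h
    apply hx
    simp [h]
  refine hu.integrable_mul_continuous ?_ ?_ (hsub.trans hψ.tsupport_gradient)
  · exact (EuclideanSpace.proj (𝕜 := ℝ) i).continuous.comp (continuous_gradient hψ.1)
  · exact hψ.hasCompactSupport_gradient.of_isClosed_subset (isClosed_tsupport _) hsub

/-- A weak gradient obeys the product rule against a cutoff, with extension by zero. -/
theorem HasWeakGradient.mul_testFunction (hu : MemL2Loc U u) (hG : MemL2Loc U G)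
    (hw : HasWeakGradient U u G) {ζ : EuclideanSpace ℝ (Fin d) → ℝ} (hζ : IsTestFunction U ζ) :
    HasWeakGradient Set.univ (fun x => ζ x * u x) (fun x => ζ x • G x + u x • gradient ζ x) := by
  have h1 : MemLp (fun x => ζ x * u x) 2 volume :=
    hu.smul_continuous hζ.1.continuous hζ.2.1 hζ.2.2
  have h2 : MemLp (fun x => ζ x • G x + u x • gradient ζ x) 2 volume :=
    (hG.smul_continuous hζ.1.continuous hζ.2.1 hζ.2.2).add
      (hu.continuous_smul (continuous_gradient hζ.1) hζ.hasCompactSupport_gradient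
        hζ.tsupport_gradient)
  refine ⟨(h1.locallyIntegrable (by simp)).locallyIntegrableOn _,
    (h2.locallyIntegrable (by simp)).locallyIntegrableOn _, fun ψ hψ i => ?_⟩
  simp only [Measure.restrict_univ]
  have hζψ : IsTestFunction U (fun x => ζ x * ψ x) := hζ.mul hψ.1
  have hψζ : IsTestFunction U (fun x => ψ x * ζ x) := by simpa only [mul_comm] using hζψ
  have hg : ∀ x, gradient (fun x => ζ x * ψ x) x i
      = ζ x * gradient ψ x i + ψ x * gradient ζ x i := by
    intro x
    rw [gradient_mul (hζ.differentiableAt x) (hψ.differentiableAt x)]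
    simp
  have i1 := hu.integrable_mul_gradient_apply hζψ i
  have i2 : Integrable (fun x => ψ x * (u x * gradient ζ x i)) volume := by
    obtain ⟨C, hC⟩ := hψ.1.continuous.bounded_above_of_compact_support hψ.2.1
    exact (hu.integrable_mul_gradient_apply hζ i).bdd_mul
      hψ.1.continuous.aestronglyMeasurable (Eventually.of_forall hC)
  have i3 : Integrable (fun x => G x i * (ζ x * ψ x)) volume :=
    (hG.apply i).integrable_mul_continuous hζψ.1.continuous hζψ.2.1 hζψ.2.2
  have e := hw.2.2 _ hζψ i
  rw [setIntegral_eq_integral_of_forall_compl_eq_zero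
      (fun x hx => by simp [hζψ.gradient_eq_zero hx]),
    setIntegral_eq_integral_of_forall_compl_eq_zero
      (fun x hx => by simp [hζ.eq_zero hx])] at e
  calc ∫ x, ζ x * u x * gradient ψ x i
      = ∫ x, (u x * gradient (fun x => ζ x * ψ x) x i - ψ x * (u x * gradient ζ x i)) := by
        refine integral_congr_ae (Eventually.of_forall fun x => ?_)
        simp only [hg]
        ring
    _ = -∫ x, (G x i * (ζ x * ψ x) + ψ x * (u x * gradient ζ x i)) := by
        rw [integral_sub i1 i2, e, integral_add i3 i2]
        ring
    _ = _ := by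
        congr 1
        refine integral_congr_ae (Eventually.of_forall fun x => ?_)
        simp only [PiLp.add_apply, PiLp.smul_apply, smul_eq_mul]
        ring

theorem inner_eq_sum_mul (v w : EuclideanSpace ℝ (Fin d)) :
    inner ℝ v w = ∑ i, w i * v i := by
  simp [PiLp.inner_apply]

/-- A distributional equation on `U` may be tested with `ζ u`, where `ζ` is a cutoff and `u` is
locally in `H¹`. -/
theorem weak_equation_mul_testFunction (hU : IsOpen U) (hu : MemL2Loc U u) (hG : MemL2Loc U G)
    (hw : HasWeakGradient U u G) {f : EuclideanSpace ℝ (Fin d) → ℝ}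
    {V : EuclideanSpace ℝ (Fin d) → EuclideanSpace ℝ (Fin d)}
    (hf : MemL2Loc U f) (hV : MemL2Loc U V)
    (heq : ∀ ψ, IsTestFunction U ψ → ∫ x in U, (ψ x * f x + inner ℝ (gradient ψ x) (V x)) = 0)
    {ζ : EuclideanSpace ℝ (Fin d) → ℝ} (hζ : IsTestFunction U ζ) :
    ∫ x in U, (ζ x * u x * f x + inner ℝ (ζ x • G x + u x • gradient ζ x) (V x)) = 0 := by
  -- Room for mollification: smoothing `ζ u` at radius at most `ε` keeps the support in the compact
  -- set `K ⊆ U`.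
  obtain ⟨ε, hε, hεU⟩ := hζ.2.1.isCompact.exists_cthickening_subset_open hU hζ.2.2
  set K := Metric.cthickening ε (tsupport ζ) with hK
  have hKc : IsCompact K := hζ.2.1.isCompact.cthickening
  have hζK : tsupport ζ ⊆ K := Metric.self_subset_cthickening _
  have hv : MemLp (fun x => ζ x * u x) 2 volume :=
    hu.smul_continuous hζ.1.continuous hζ.2.1 hζ.2.2
  have hH : MemLp (fun x => ζ x • G x + u x • gradient ζ x) 2 volume :=
    (hG.smul_continuous hζ.1.continuous hζ.2.1 hζ.2.2).add
      (hu.continuous_smul (continuous_gradient hζ.1) hζ.hasCompactSupport_gradient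
        hζ.tsupport_gradient)
  have hwv := HasWeakGradient.mul_testFunction hu hG hw hζ
  set v := fun x => ζ x * u x with hvdef
  set H := fun x => ζ x • G x + u x • gradient ζ x with hHdef
  have hHi : ∀ i, MemLp (fun x => H x i) 2 volume := fun i => by
    refine hH.of_le_mul (c := 1) ?_ (Eventually.of_forall fun x => ?_)
    · exact (EuclideanSpace.proj (𝕜 := ℝ) i).continuous.comp_aestronglyMeasurable hH.1
    · rw [one_mul]
      exact PiLp.norm_apply_le (H x) i
  have hf' : MemLp (K.indicator f) 2 volume := hf.memLp_indicator hKc hεU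
  have hV' : ∀ i, MemLp (K.indicator fun x => V x i) 2 volume :=
    fun i => (hV.apply i).memLp_indicator hKc hεU
  -- Writes the tested equation as a finite sum of scalar `L²` pairings with the fixed functions
  -- `1_K f` and `1_K V i`, the form in which weak convergence applies.
  have key : ∀ (w : EuclideanSpace ℝ (Fin d) → ℝ)
      (W : EuclideanSpace ℝ (Fin d) → EuclideanSpace ℝ (Fin d)), MemLp w 2 volume →
      (∀ i, MemLp (fun x => W x i) 2 volume) → (∀ x, x ∉ K → w x = 0) → (∀ x, x ∉ K → W x = 0) →
      ∫ x in U, (w x * f x + inner ℝ (W x) (V x)) =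
        (∫ x, K.indicator f x * w x) + ∑ i, ∫ x, K.indicator (fun x => V x i) x * W x i := by
    intro w W h1 h2 h3 h4
    have i2 : ∀ i, Integrable (fun x => K.indicator (fun x => V x i) x * W x i) volume :=
      fun i => (hV' i).integrable_mul (h2 i)
    have i1 : Integrable (fun x => K.indicator f x * w x) volume := hf'.integrable_mul h1
    rw [setIntegral_eq_integral_of_forall_compl_eq_zero (fun x hx => by
      simp [h3 x fun h => hx (hεU h), h4 x fun h => hx (hεU h)]),
      ← integral_finsetSum _ fun i _ => i2 i, ← integral_add i1 (integrable_finsetSum _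
        fun i _ => i2 i)]
    refine integral_congr_ae (Eventually.of_forall fun x => ?_)
    by_cases hx : x ∈ K
    · simp [hx, inner_eq_sum_mul, mul_comm]
    · simp [hx, h3 x hx, h4 x hx]
  let ρ : ℕ → ContDiffBump (0 : EuclideanSpace ℝ (Fin d)) := fun n =>
    ⟨ε / (n + 1) / 2, ε / (n + 1), by positivity, half_lt_self (by positivity)⟩
  have hρ : Tendsto (fun n => (ρ n).rOut) atTop (𝓝 0) :=
    by simpa [ρ, div_eq_mul_inv] using
      (tendsto_one_div_add_atTop_nhds_zero_nat (𝕜 := ℝ)).const_mul ε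
  have hlim : Tendsto (fun n => (∫ x, K.indicator f x * convolution ((ρ n).normed volume) v
      (ContinuousLinearMap.lsmul ℝ ℝ) volume x) + ∑ i, ∫ x, K.indicator (fun x => V x i) x *
        convolution ((ρ n).normed volume) (fun x => H x i)
          (ContinuousLinearMap.lsmul ℝ ℝ) volume x) atTop
      (𝓝 ((∫ x, K.indicator f x * v x) + ∑ i, ∫ x, K.indicator (fun x => V x i) x * H x i)) :=
    (tendsto_integral_mul_convolution hf' hv ρ hρ).add
      (tendsto_finsetSum _ fun i _ => tendsto_integral_mul_convolution (hV' i) (hHi i) ρ hρ)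
  rw [← key v H hv hHi] at hlim
  · refine tendsto_nhds_unique hlim ?_
    refine tendsto_const_nhds.congr fun n => ?_
    set w := convolution ((ρ n).normed volume) v (ContinuousLinearMap.lsmul ℝ ℝ) volume with hwdef
    have hsm : ContDiff ℝ ∞ w := ((ρ n).hasCompactSupport_normed).contDiff_convolution_left _
      (ρ n).contDiff_normed (hv.locallyIntegrable (by simp))
    have hsupp : tsupport w ⊆ K := by
      refine closure_minimal ?_ Metric.isClosed_cthickening
      refine (support_convolution_subset _).trans ?_
      rintro _ ⟨a, ha, b, hb, rfl⟩
      rw [ContDiffBump.support_normed_eq, Metric.mem_ball, dist_zero_right] at ha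
      refine Metric.mem_cthickening_of_dist_le _ b _ _ (subset_tsupport _ (left_ne_zero_of_mul hb)) ?_
      simp only [dist_eq_norm, add_sub_cancel_right]
      refine ha.le.trans (div_le_self hε.le ?_)
      have : (0 : ℝ) ≤ n := n.cast_nonneg
      linarith
    have hcs : HasCompactSupport w := hKc.of_isClosed_subset (isClosed_tsupport _) hsupp
    have htest : IsTestFunction U w := ⟨hsm, hcs, hsupp.trans hεU⟩
    have hgr : ∀ i x, convolution ((ρ n).normed volume) (fun x => H x i)
          (ContinuousLinearMap.lsmul ℝ ℝ) volume x = gradient w x i := fun i x =>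
      (gradient_convolution_apply hwv (ρ n).contDiff_normed
        (ρ n).hasCompactSupport_normed x i).symm
    simp only [hgr]
    rw [← key w (gradient w) (hsm.continuous.memLp_of_hasCompactSupport hcs), heq w htest]
    · intro i
      have hc : Continuous fun x => gradient w x i :=
        (EuclideanSpace.proj (𝕜 := ℝ) i).continuous.comp (continuous_gradient hsm)
      refine hc.memLp_of_hasCompactSupport
        (htest.hasCompactSupport_gradient.of_isClosed_subset (isClosed_tsupport _) ?_)
      refine closure_mono fun x hx h => hx ?_
      simp [h]
    · exact fun x hx => image_eq_zero_of_notMem_tsupport fun h => hx (hsupp h)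
    · exact fun x hx => image_eq_zero_of_notMem_tsupport fun h =>
        hx (hsupp (tsupport_gradient_subset _ h))
  · intro x hx
    simp [hvdef, image_eq_zero_of_notMem_tsupport fun h => hx (hζK h)]
  · intro x hx
    simp [hHdef, image_eq_zero_of_notMem_tsupport fun h => hx (hζK h),
      image_eq_zero_of_notMem_tsupport fun h => hx (hζK (tsupport_gradient_subset ζ h))]

end Extension

/-! ### Ellipticity and Caccioppoli's inequality. -/

section Energy

variable {d : ℕ} {α β : ℝ}

theorem abs_inner_toEuclideanLin_le {M : Matrix (Fin d) (Fin d) ℝ}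
    (hM : M ∈ ellipticMatrices d α β) (v w : EuclideanSpace ℝ (Fin d)) :
    |inner ℝ v (Matrix.toEuclideanLin M w)| ≤ β * (‖v‖ * ‖w‖) :=
  calc |inner ℝ v (Matrix.toEuclideanLin M w)| ≤ ‖v‖ * ‖Matrix.toEuclideanLin M w‖ :=
        abs_real_inner_le_norm _ _
    _ ≤ ‖v‖ * (β * ‖w‖) := by gcongr; exact (hM w).2
    _ = _ := by ring

/-- The pointwise energy inequality behind the Caccioppoli estimate. -/
theorem energy_le_inner_add (hα : 0 < α) (hαβ : α ≤ β) {M : Matrix (Fin d) (Fin d) ℝ}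
    (hM : M ∈ ellipticMatrices d α β) (h u : ℝ) (g G ξ : EuclideanSpace ℝ (Fin d)) :
    α / 2 * (h * ‖G‖) ^ 2 ≤
      inner ℝ (h ^ 2 • G + u • ((2 * h) • g)) (Matrix.toEuclideanLin M (ξ + G)) +
        (8 * β ^ 2 / α + β) * ((u * ‖g‖) ^ 2 + (h * ‖ξ‖) ^ 2) := by
  have hβ : 0 ≤ β := hα.le.trans hαβ
  have e1 := (hM G).1
  have e2 := abs_inner_toEuclideanLin_le hM G ξ
  have e3 := abs_inner_toEuclideanLin_le hM g G
  have e4 := abs_inner_toEuclideanLin_le hM g ξ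
  rw [map_add]
  simp only [inner_add_left, inner_add_right, real_inner_smul_left]
  set p := inner ℝ G (Matrix.toEuclideanLin M G)
  set q := inner ℝ G (Matrix.toEuclideanLin M ξ)
  set r := inner ℝ g (Matrix.toEuclideanLin M G)
  set s := inner ℝ g (Matrix.toEuclideanLin M ξ)
  have f1 : α * (|h| * ‖G‖) ^ 2 ≤ h ^ 2 * p := by
    rw [mul_pow, sq_abs]
    nlinarith [sq_nonneg h]
  have f2 : -(β * (|h| * ‖G‖) * (|h| * ‖ξ‖)) ≤ h ^ 2 * q := by
    have : |h ^ 2 * q| ≤ |h| ^ 2 * (β * (‖G‖ * ‖ξ‖)) := by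
      rw [abs_mul, abs_pow]; gcongr
    nlinarith [neg_abs_le (h ^ 2 * q)]
  have f3 : -(2 * β * (|h| * ‖G‖) * (|u| * ‖g‖)) ≤ u * (2 * h * r) := by
    have : |u * (2 * h * r)| ≤ |u| * (2 * |h| * (β * (‖g‖ * ‖G‖))) := by
      rw [abs_mul, abs_mul, abs_mul, abs_two]; gcongr
    nlinarith [neg_abs_le (u * (2 * h * r))]
  have f4 : -(2 * β * (|u| * ‖g‖) * (|h| * ‖ξ‖)) ≤ u * (2 * h * s) := by
    have : |u * (2 * h * s)| ≤ |u| * (2 * |h| * (β * (‖g‖ * ‖ξ‖))) := by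
      rw [abs_mul, abs_mul, abs_mul, abs_two]; gcongr
    nlinarith [neg_abs_le (u * (2 * h * s))]
  have g1 : (h * ‖G‖) ^ 2 = (|h| * ‖G‖) ^ 2 := by rw [mul_pow, mul_pow, sq_abs]
  have g2 : (u * ‖g‖) ^ 2 = (|u| * ‖g‖) ^ 2 := by rw [mul_pow, mul_pow, sq_abs]
  have g3 : (h * ‖ξ‖) ^ 2 = (|h| * ‖ξ‖) ^ 2 := by rw [mul_pow, mul_pow, sq_abs]
  rw [g1, g2, g3]
  generalize |h| * ‖G‖ = X at *
  generalize |u| * ‖g‖ = Y at *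
  generalize |h| * ‖ξ‖ = Z at *
  -- With the ellipticity ratio `κ` the division by `α` disappears. The squares `s1`, `s2`, `s3`
  -- below absorb the cross terms `XZ`, `XY`, `YZ`, at the cost of `α / 4 * X ^ 2`.
  obtain ⟨κ, rfl⟩ : ∃ κ, β = κ * α := ⟨β / α, by field_simp⟩
  have hκ : 8 * (κ * α) ^ 2 / α = 8 * κ ^ 2 * α := by field_simp
  rw [hκ]
  have s1 : 0 ≤ α / 8 * (X - 4 * κ * Z) ^ 2 := by positivity
  have s2 : 0 ≤ α / 8 * (X - 8 * κ * Y) ^ 2 := by positivity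
  have s3 : 0 ≤ κ * α * (Y - Z) ^ 2 := by positivity
  have s4 : 0 ≤ κ ^ 2 * α * Z ^ 2 := by positivity
  have s5 : 0 ≤ α * X ^ 2 := by positivity
  nlinarith

theorem IsCoefficientField.aestronglyMeasurable_flux
    {A : EuclideanSpace ℝ (Fin d) → Matrix (Fin d) (Fin d) ℝ} (hA : IsCoefficientField α β A)
    {V : EuclideanSpace ℝ (Fin d) → EuclideanSpace ℝ (Fin d)}
    {K : Set (EuclideanSpace ℝ (Fin d))} (hV : AEStronglyMeasurable V (volume.restrict K)) :
    AEStronglyMeasurable (fun x => Matrix.toEuclideanLin (A x) (V x)) (volume.restrict K) := by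
  refine AEMeasurable.aestronglyMeasurable ?_
  refine (PiLp.continuous_toLp 2 _).measurable.comp_aemeasurable
    (aemeasurable_pi_lambda _ fun i => ?_)
  have : (fun x => (A x).mulVec (V x).ofLp i) = fun x => ∑ j, A x i j * V x j := by
    ext x
    rfl
  refine this ▸ Finset.aemeasurable_fun_sum _ fun j _ => ((hA.1 i j).restrict).mul ?_
  exact (EuclideanSpace.proj (𝕜 := ℝ) j).continuous.measurable.comp_aemeasurable hV.aemeasurable

theorem IsCoefficientField.memLp_flux
    {A : EuclideanSpace ℝ (Fin d) → Matrix (Fin d) (Fin d) ℝ} (hA : IsCoefficientField α β A)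
    {V : EuclideanSpace ℝ (Fin d) → EuclideanSpace ℝ (Fin d)}
    {K : Set (EuclideanSpace ℝ (Fin d))} (hV : MemLp V 2 (volume.restrict K)) :
    MemLp (fun x => Matrix.toEuclideanLin (A x) (V x)) 2 (volume.restrict K) :=
  hV.of_le_mul (c := β) (hA.aestronglyMeasurable_flux hV.1)
    ((ae_restrict_of_ae hA.2).mono fun x hx => (hx (V x)).2)

theorem IsCoefficientField.memL2Loc_flux
    {A : EuclideanSpace ℝ (Fin d) → Matrix (Fin d) (Fin d) ℝ} (hA : IsCoefficientField α β A)
    {U : Set (EuclideanSpace ℝ (Fin d))}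
    {V : EuclideanSpace ℝ (Fin d) → EuclideanSpace ℝ (Fin d)} (hV : MemL2Loc U V) :
    MemL2Loc U (fun x => Matrix.toEuclideanLin (A x) (V x)) :=
  fun K hK hKU => hA.memLp_flux (hV K hK hKU)

theorem integrable_inner_of_memLp {Ω : Type*} [MeasurableSpace Ω] {μ : Measure Ω}
    {v w : Ω → EuclideanSpace ℝ (Fin d)} (hv : MemLp v 2 μ) (hw : MemLp w 2 μ) :
    Integrable (fun x => inner ℝ (v x) (w x)) μ := by
  refine (hv.norm.integrable_mul hw.norm).mono' (hv.1.inner hw.1)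
    (Eventually.of_forall fun x => ?_)
  exact norm_inner_le_norm _ _

theorem memL2Loc_const_add {U : Set (EuclideanSpace ℝ (Fin d))}
    {G : EuclideanSpace ℝ (Fin d) → EuclideanSpace ℝ (Fin d)} (hG : MemL2Loc U G)
    (ξ : EuclideanSpace ℝ (Fin d)) : MemL2Loc U (fun x => ξ + G x) := by
  intro K hK hKU
  have : IsFiniteMeasure (volume.restrict K) := ⟨by simpa using hK.measure_lt_top⟩
  exact (memLp_const ξ).add (hG K hK hKU)

/-- **Caccioppoli's inequality** for `T⁻¹ u - ∇ · A (ξ + ∇u) = 0` on `U`. -/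
theorem caccioppoli (hα : 0 < α) (hαβ : α ≤ β)
    {A : EuclideanSpace ℝ (Fin d) → Matrix (Fin d) (Fin d) ℝ} (hA : IsCoefficientField α β A)
    {U : Set (EuclideanSpace ℝ (Fin d))} (hU : IsOpen U) {u : EuclideanSpace ℝ (Fin d) → ℝ}
    {G : EuclideanSpace ℝ (Fin d) → EuclideanSpace ℝ (Fin d)} (hu : MemL2Loc U u)
    (hG : MemL2Loc U G) (hw : HasWeakGradient U u G) {T : ℝ} {ξ : EuclideanSpace ℝ (Fin d)}
    (heq : ∀ ψ, IsTestFunction U ψ → ∫ x in U, (T⁻¹ * ψ x * u x +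
      inner ℝ (gradient ψ x) (Matrix.toEuclideanLin (A x) (ξ + G x))) = 0)
    {η : EuclideanSpace ℝ (Fin d) → ℝ} (hη : IsTestFunction U η) :
    ∫ x in U, (T⁻¹ * (η x * u x) ^ 2 + α / 2 * (η x * ‖G x‖) ^ 2) ≤
      (8 * β ^ 2 / α + β) *
        ∫ x in U, ((u x * ‖gradient η x‖) ^ 2 + (η x * ‖ξ‖) ^ 2) := by
  have hζ : IsTestFunction U (fun x => η x * η x) := hη.mul hη.1
  have hgζ : ∀ x, gradient (fun x => η x * η x) x = (2 * η x) • gradient η x := by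
    intro x
    rw [gradient_mul (hη.differentiableAt x) (hη.differentiableAt x), two_mul, add_smul]
  have hV := hA.memL2Loc_flux (memL2Loc_const_add hG ξ)
  have hf : MemL2Loc U (fun x => T⁻¹ * u x) := fun K hK hKU => (hu K hK hKU).const_mul _
  -- The choice `ζ = η²` means testing with `η² u`.
  have heq' := weak_equation_mul_testFunction hU hu hG hw hf hV
    (fun ψ hψ => by rw [← heq ψ hψ]; congr 1; ext x; ring) hζ
  have m1 : MemLp (fun x => η x * u x) 2 volume :=
    hu.smul_continuous hη.1.continuous hη.2.1 hη.2.2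
  have m2 : MemLp (fun x => η x • G x) 2 volume :=
    hG.smul_continuous hη.1.continuous hη.2.1 hη.2.2
  have m3 : MemLp (fun x => u x • gradient η x) 2 volume :=
    hu.continuous_smul (continuous_gradient hη.1) hη.hasCompactSupport_gradient
      hη.tsupport_gradient
  have m4 : MemLp (fun x => η x • ξ) 2 volume :=
    (hη.1.continuous.smul continuous_const).memLp_of_hasCompactSupport hη.2.1.smul_right
  have m5 : MemLp (fun x => η x • Matrix.toEuclideanLin (A x) (ξ + G x)) 2 volume :=
    hV.smul_continuous hη.1.continuous hη.2.1 hη.2.2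
  have i1 : Integrable (fun x => T⁻¹ * (η x * u x) ^ 2) volume := m1.integrable_sq.const_mul _
  have i2 : Integrable (fun x => (η x * ‖G x‖) ^ 2) volume :=
    m2.norm.integrable_sq.congr (Eventually.of_forall fun x => by simp [norm_smul, mul_pow])
  have i3 : Integrable (fun x => (u x * ‖gradient η x‖) ^ 2) volume :=
    m3.norm.integrable_sq.congr (Eventually.of_forall fun x => by simp [norm_smul, mul_pow])
  have i4 : Integrable (fun x => (η x * ‖ξ‖) ^ 2) volume :=
    m4.norm.integrable_sq.congr (Eventually.of_forall fun x => by simp [norm_smul, mul_pow])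
  have i5 : Integrable (fun x => η x * η x * u x * (T⁻¹ * u x) +
      inner ℝ ((η x * η x) • G x + u x • gradient (fun x => η x * η x) x)
        (Matrix.toEuclideanLin (A x) (ξ + G x))) volume := by
    refine (i1.add (integrable_inner_of_memLp (m2.add (m3.const_smul (2 : ℝ))) m5)).congr
      (Eventually.of_forall fun x => ?_)
    simp only [Pi.add_apply, Pi.smul_apply, hgζ, inner_add_left, real_inner_smul_left,
      real_inner_smul_right]
    ring
  have i6 : Integrable (fun x => (8 * β ^ 2 / α + β) *
      ((u x * ‖gradient η x‖) ^ 2 + (η x * ‖ξ‖) ^ 2)) volume := (i3.add i4).const_mul _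
  calc ∫ x in U, (T⁻¹ * (η x * u x) ^ 2 + α / 2 * (η x * ‖G x‖) ^ 2)
      ≤ ∫ x in U, ((η x * η x * u x * (T⁻¹ * u x) +
          inner ℝ ((η x * η x) • G x + u x • gradient (fun x => η x * η x) x)
          (Matrix.toEuclideanLin (A x) (ξ + G x))) +
          (8 * β ^ 2 / α + β) * ((u x * ‖gradient η x‖) ^ 2 + (η x * ‖ξ‖) ^ 2)) := by
        refine integral_mono_ae (i1.add (i2.const_mul _)).restrict
          (i5.add i6).restrict ?_
        filter_upwards [ae_restrict_of_ae hA.2] with x hx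
        have := energy_le_inner_add hα hαβ hx (η x) (u x) (gradient η x) (G x) ξ
        rw [hgζ, ← pow_two]
        linarith
    _ = _ := by
        rw [integral_add i5.restrict i6.restrict, heq', zero_add,
          integral_const_mul]

end Energy

/-! ### Energy of the whole-space corrector on large balls. -/

section Corrector

variable {d : ℕ}

/-- A uniform bound on unit balls gives volume growth on large balls. -/
theorem setLIntegral_ball_le_of_unit_balls {h : EuclideanSpace ℝ (Fin d) → ENNReal}
    (hm : AEMeasurable h volume) {Λ : ENNReal}
    (hΛ : ∀ x : EuclideanSpace ℝ (Fin d), ∫⁻ y in Metric.ball x 1, h y ≤ Λ) {r : ℝ} (hr : 0 ≤ r) :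
    ∫⁻ y in Metric.ball (0 : EuclideanSpace ℝ (Fin d)) r, h y ≤
      Λ * ENNReal.ofReal ((r + 1) ^ d) := by
  set B := Metric.ball (0 : EuclideanSpace ℝ (Fin d)) r with hB
  set V := volume (Metric.ball (0 : EuclideanSpace ℝ (Fin d)) 1) with hV
  have hV0 : V ≠ 0 := (Metric.measure_ball_pos _ _ one_pos).ne'
  have hVt : V ≠ ⊤ := measure_ball_lt_top.ne
  -- Double counting: integrating first in `x` gives `|B₁|` times the integral of `h` over `B`;
  -- integrating first in `y` gives at most `Λ`, and only for `x` in the ball of radius `r + 1`. The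
  -- factor `|B₁|` then cancels.
  let F : EuclideanSpace ℝ (Fin d) → EuclideanSpace ℝ (Fin d) → ENNReal :=
    fun y x => B.indicator h y * (Metric.ball y 1).indicator 1 x
  have hF : AEMeasurable (Function.uncurry F) (volume.prod volume) := by
    refine AEMeasurable.mul ?_ ?_
    · exact (hm.indicator Metric.isOpen_ball.measurableSet).comp_fst
    · have hs : MeasurableSet {p : EuclideanSpace ℝ (Fin d) × EuclideanSpace ℝ (Fin d) |
          dist p.2 p.1 < 1} :=
        (isOpen_lt (continuous_snd.dist continuous_fst) continuous_const).measurableSet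
      exact ((measurable_one (α := ENNReal)).indicator hs).aemeasurable
  have h1 : ∫⁻ y, ∫⁻ x, F y x = (∫⁻ y in B, h y) * V := by
    have : ∀ y, ∫⁻ x, F y x = B.indicator h y * V := by
      intro y
      rw [lintegral_const_mul _ (measurable_one.indicator Metric.isOpen_ball.measurableSet),
        lintegral_indicator_one Metric.isOpen_ball.measurableSet,
        Measure.addHaar_ball_center volume y 1]
    simp only [this]
    rw [lintegral_mul_const' _ _ hVt, lintegral_indicator Metric.isOpen_ball.measurableSet]
  have h2 : ∀ x, ∫⁻ y, F y x ≤
      (Metric.ball (0 : EuclideanSpace ℝ (Fin d)) (r + 1)).indicator (fun _ => Λ) x := by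
    intro x
    by_cases hx : x ∈ Metric.ball (0 : EuclideanSpace ℝ (Fin d)) (r + 1)
    · rw [Set.indicator_of_mem hx]
      refine le_trans ?_ (hΛ x)
      rw [← lintegral_indicator Metric.isOpen_ball.measurableSet]
      refine lintegral_mono fun y => ?_
      by_cases hy : x ∈ Metric.ball y 1
      · have hy' : y ∈ Metric.ball x 1 := Metric.mem_ball_comm.1 hy
        simp only [F, Set.indicator_of_mem hy, Set.indicator_of_mem hy', Pi.one_apply, mul_one]
        exact Set.indicator_le_self _ _ _
      · simp [F, hy]
    · rw [Set.indicator_of_notMem hx]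
      refine le_of_eq ?_
      rw [← lintegral_zero (μ := (volume : Measure (EuclideanSpace ℝ (Fin d))))]
      congr 1
      ext y
      by_cases hy : x ∈ Metric.ball y 1
      · have hyB : y ∉ B := by
          intro hyB
          apply hx
          rw [Metric.mem_ball] at *
          linarith [dist_triangle x y 0]
        simp [F, hyB]
      · simp [F, hy]
  have h3 : (∫⁻ y in B, h y) * V ≤ Λ * (ENNReal.ofReal ((r + 1) ^ d) * V) :=
    calc (∫⁻ y in B, h y) * V = ∫⁻ x, ∫⁻ y, F y x := by rw [← h1, lintegral_lintegral_swap hF]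
      _ ≤ ∫⁻ x, (Metric.ball (0 : EuclideanSpace ℝ (Fin d)) (r + 1)).indicator (fun _ => Λ) x :=
        lintegral_mono h2
      _ = Λ * volume (Metric.ball (0 : EuclideanSpace ℝ (Fin d)) (r + 1)) := by
        rw [lintegral_indicator Metric.isOpen_ball.measurableSet, setLIntegral_const]
      _ = _ := by
        rw [Measure.addHaar_ball_of_pos volume _ (by linarith), finrank_euclideanSpace_fin]
  rw [← mul_assoc] at h3
  exact (ENNReal.mul_le_mul_iff_left hV0 hVt).1 h3

/-- A quantity of at most volume growth that obeys a contractive doubling inequality is bounded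
independently of its growth constant. -/
theorem le_of_doubling_contraction {a : ℝ → ℝ} {C Λ r₀ : ℝ} (hr₀ : 0 ≤ r₀)
    (h1 : ∀ r, r₀ ≤ r → a r ≤ (2 ^ d)⁻¹ / 2 * a (2 * r) + C * r ^ d)
    (h2 : ∀ r, r₀ ≤ r → a r ≤ Λ * r ^ d) {r : ℝ} (hr : r₀ ≤ r) : a r ≤ 2 * C * r ^ d := by
  -- Passing to radius `2r` multiplies `r^d` by `2^d`, which the prefactor cancels with a spare
  -- `1/2`; thus each iteration halves the excess over the fixed point `2C`.
  have key : ∀ n : ℕ, ∀ r, r₀ ≤ r → 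
      a r ≤ (2 * C + (|Λ| + 2 * |C|) / 2 ^ n) * r ^ d := by
    intro n
    induction n with
    | zero =>
      intro r hr
      have : 0 ≤ r ^ d := pow_nonneg (hr₀.trans hr) d
      refine (h2 r hr).trans ?_
      gcongr
      simp only [pow_zero, div_one]
      linarith [le_abs_self Λ, neg_abs_le C]
    | succ n ih =>
      intro r hr
      have h3 := ih (2 * r) (by linarith)
      rw [mul_pow] at h3
      have h4 : (2 ^ d : ℝ)⁻¹ / 2 * a (2 * r) ≤ (2 ^ d : ℝ)⁻¹ / 2 *
          ((2 * C + (|Λ| + 2 * |C|) / 2 ^ n) * (2 ^ d * r ^ d)) := by gcongr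
      refine (h1 r hr).trans ((add_le_add_left h4 _).trans (le_of_eq ?_))
      field_simp
      ring
  have hlim : Tendsto (fun n : ℕ => (2 * C + (|Λ| + 2 * |C|) / 2 ^ n) * r ^ d) atTop
      (𝓝 ((2 * C + 0) * r ^ d)) := by
    refine (tendsto_const_nhds.add ?_).mul_const _
    have := (tendsto_pow_atTop_nhds_zero_of_lt_one (r := (1 / 2 : ℝ)) (by norm_num)
      (by norm_num)).const_mul (|Λ| + 2 * |C|)
    rw [mul_zero] at this
    refine this.congr fun n => ?_
    rw [one_div, inv_pow, div_eq_mul_inv]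
  rw [add_zero] at hlim
  refine ge_of_tendsto' hlim fun n => ?_
  exact key n r hr

/-- Cutoff functions adapted to concentric balls. -/
theorem exists_ball_cutoff (d : ℕ) : ∃ M : ℝ, 0 < M ∧ ∀ r : ℝ, 0 < r →
    ∃ η : EuclideanSpace ℝ (Fin d) → ℝ, IsTestFunction (Metric.ball 0 (2 * r)) η ∧
      (∀ x ∈ Metric.ball (0 : EuclideanSpace ℝ (Fin d)) r, η x = 1) ∧
      (∀ x, 0 ≤ η x) ∧ (∀ x, η x ≤ 1) ∧ ∀ x, ‖gradient η x‖ ≤ M / r := by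
  -- One fixed profile is rescaled by `r`; an outer radius below `2` keeps the closed support inside
  -- the open ball of radius `2r`.
  let χ : ContDiffBump (0 : EuclideanSpace ℝ (Fin d)) := ⟨1, 3 / 2, one_pos, by norm_num⟩
  have hχ : ContDiff ℝ ∞ χ := χ.contDiff
  obtain ⟨M, hM⟩ := (hχ.continuous_fderiv (by simp)).bounded_above_of_compact_support
    (χ.hasCompactSupport.fderiv ℝ)
  have hM0 : 0 ≤ M := (norm_nonneg _).trans (hM 0)
  refine ⟨M + 1, by linarith, fun r hr => ⟨fun x => χ (r⁻¹ • x), ⟨?_, ?_, ?_⟩, ?_, ?_, ?_, ?_⟩⟩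
  · exact hχ.comp (contDiff_const_smul _)
  · exact χ.hasCompactSupport.comp_smul (inv_ne_zero hr.ne')
  · have hc : IsClosed (Metric.closedBall (0 : EuclideanSpace ℝ (Fin d)) (3 / 2 * r)) :=
      Metric.isClosed_closedBall
    refine (closure_minimal (fun x hx => ?_) hc).trans
      (Metric.closedBall_subset_ball (by linarith))
    have h1 : r⁻¹ • x ∈ Function.support χ := hx
    rw [χ.support_eq, Metric.mem_ball, dist_zero_right, norm_smul, norm_inv, Real.norm_eq_abs,
      abs_of_pos hr, inv_mul_lt_iff₀ hr] at h1
    have h2 : ‖x‖ < r * (3 / 2) := h1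
    rw [mem_closedBall_zero_iff]
    linarith
  · intro x hx
    refine χ.one_of_mem_closedBall ?_
    rw [mem_ball_zero_iff] at hx
    rw [mem_closedBall_zero_iff, norm_smul, norm_inv, Real.norm_eq_abs, abs_of_pos hr,
      inv_mul_le_iff₀ hr]
    linarith
  · exact fun x => χ.nonneg
  · exact fun x => χ.le_one
  · intro x
    have h1 : HasFDerivAt (fun x => χ (r⁻¹ • x)) ((fderiv ℝ χ (r⁻¹ • x)).comp
        (r⁻¹ • ContinuousLinearMap.id ℝ (EuclideanSpace ℝ (Fin d)))) x :=
      ((hχ.differentiable (by simp)).differentiableAt.hasFDerivAt).comp x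
        ((hasFDerivAt_id x).const_smul r⁻¹)
    rw [gradient, LinearIsometryEquiv.norm_map, h1.fderiv, ContinuousLinearMap.comp_smul,
      ContinuousLinearMap.comp_id, norm_smul, norm_inv, Real.norm_eq_abs, abs_of_pos hr,
      inv_mul_eq_div]
    gcongr
    linarith [hM (r⁻¹ • x)]

/-- The energy of the regularized corrector on a large ball is controlled by the volume. -/
theorem exists_corrector_energy_bound (d : ℕ) {α β : ℝ} (hα : 0 < α) (hαβ : α ≤ β) :
    ∃ K C : ℝ, 0 < K ∧ 0 < C ∧
      ∀ (A : EuclideanSpace ℝ (Fin d) → Matrix (Fin d) (Fin d) ℝ)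
        (ξ : EuclideanSpace ℝ (Fin d)) (T : ℝ) (φ : EuclideanSpace ℝ (Fin d) → ℝ)
        (G : EuclideanSpace ℝ (Fin d) → EuclideanSpace ℝ (Fin d)),
        IsCoefficientField α β A → ‖ξ‖ = 1 → 0 < T → IsRegularizedCorrector A ξ T φ G →
        ∀ r : ℝ, 1 ≤ r → K * Real.sqrt T ≤ r →
          ∫ x in Metric.ball 0 r, (T⁻¹ * φ x ^ 2 + α / 2 * ‖G x‖ ^ 2) ≤ C * r ^ d := by
  obtain ⟨M, hM, hcut⟩ := exists_ball_cutoff d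
  have hβ : 0 < β := hα.trans_le hαβ
  set C₁ := 8 * β ^ 2 / α + β with hC₁
  have hC₁pos : 0 < C₁ := by positivity
  set κ := volume.real (Metric.ball (0 : EuclideanSpace ℝ (Fin d)) 1) with hκ
  have hκpos : 0 < κ :=
    ENNReal.toReal_pos (Metric.measure_ball_pos _ _ one_pos).ne' measure_ball_lt_top.ne
  -- Exactly the threshold at which, for `r ≥ K √T`, the cutoff error `C₁ (M / r)²` is at most
  -- `2^{-d} / 2` times the mass `T⁻¹`.
  set K := Real.sqrt (C₁ * M ^ 2 * (2 * 2 ^ d)) with hK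
  have hKpos : 0 < K := Real.sqrt_pos.2 (by positivity)
  have hK2 : K ^ 2 = C₁ * M ^ 2 * (2 * 2 ^ d) := Real.sq_sqrt (by positivity)
  refine ⟨K, 2 * (C₁ * 2 ^ d * κ), hKpos, by positivity, ?_⟩
  intro A ξ T φ G hA hξ hT hφ r hr1 hrK
  have hloc : MemL2Loc Set.univ φ := fun S hS _ => (hφ.memH1Loc.1 S hS).1
  have hGloc : MemL2Loc Set.univ G := fun S hS _ => (hφ.memH1Loc.1 S hS).2
  have hball : ∀ (x : EuclideanSpace ℝ (Fin d)) (r : ℝ),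
      IntegrableOn (fun y => φ y ^ 2) (Metric.ball x r) ∧
        IntegrableOn (fun y => ‖G y‖ ^ 2) (Metric.ball x r) := by
    intro x r
    have hs := isCompact_closedBall x r
    exact ⟨IntegrableOn.mono_set (hloc _ hs (Set.subset_univ _)).integrable_sq
        Metric.ball_subset_closedBall,
      IntegrableOn.mono_set (hGloc _ hs (Set.subset_univ _)).norm.integrable_sq
        Metric.ball_subset_closedBall⟩
  have hball' : ∀ (x : EuclideanSpace ℝ (Fin d)) (r : ℝ),
      IntegrableOn (fun y => T⁻¹ * φ y ^ 2 + α / 2 * ‖G y‖ ^ 2) (Metric.ball x r) :=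
    fun x r => ((hball x r).1.const_mul _).add ((hball x r).2.const_mul _)
  obtain ⟨Λ, hΛ⟩ := hφ.unif_bound
  have hΛ' : ∀ x : EuclideanSpace ℝ (Fin d),
      ∫ y in Metric.ball x 1, (φ y ^ 2 + ‖G y‖ ^ 2) ≤ Λ := fun x => hΛ ⟨x, rfl⟩
  have hΛ0 : 0 ≤ Λ := (integral_nonneg fun y => by positivity).trans (hΛ' 0)
  have hmeas : AEMeasurable (fun y => ENNReal.ofReal (φ y ^ 2 + ‖G y‖ ^ 2)) volume := by
    have h1 : LocallyIntegrable φ volume := locallyIntegrableOn_univ.1 hφ.memH1Loc.2.1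
    have h2 : LocallyIntegrable G volume := locallyIntegrableOn_univ.1 hφ.memH1Loc.2.2.1
    exact ((h1.aestronglyMeasurable.aemeasurable.pow_const 2).add
      (h2.aestronglyMeasurable.norm.aemeasurable.pow_const 2)).ennreal_ofReal
  -- This `Λ` depends on `φ`. It enters only as the growth constant of `le_of_doubling_contraction`,
  -- whose conclusion does not contain it.
  have growth : ∀ r : ℝ, 1 ≤ r →
      ∫ x in Metric.ball 0 r, (φ x ^ 2 + ‖G x‖ ^ 2) ≤ Λ * (2 * r) ^ d := by
    intro r hr
    have hint : ∀ (x : EuclideanSpace ℝ (Fin d)) (r : ℝ),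
        ENNReal.ofReal (∫ y in Metric.ball x r, (φ y ^ 2 + ‖G y‖ ^ 2)) =
        ∫⁻ y in Metric.ball x r, ENNReal.ofReal (φ y ^ 2 + ‖G y‖ ^ 2) := fun x r =>
      ofReal_integral_eq_lintegral_ofReal ((hball x r).1.add (hball x r).2)
        (Eventually.of_forall fun y => by positivity)
    have h1 := setLIntegral_ball_le_of_unit_balls hmeas (Λ := ENNReal.ofReal Λ)
      (fun x => by rw [← hint]; exact ENNReal.ofReal_le_ofReal (hΛ' x)) (zero_le_one.trans hr)
    rw [← hint, ← ENNReal.ofReal_mul hΛ0, ENNReal.ofReal_le_ofReal_iff (by positivity)] at h1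
    refine h1.trans ?_
    gcongr
    linarith
  have step : ∀ r : ℝ, max 1 (K * Real.sqrt T) ≤ r →
      ∫ x in Metric.ball 0 r, (T⁻¹ * φ x ^ 2 + α / 2 * ‖G x‖ ^ 2) ≤
      (2 ^ d)⁻¹ / 2 * (∫ x in Metric.ball 0 (2 * r), (T⁻¹ * φ x ^ 2 + α / 2 * ‖G x‖ ^ 2)) +
        C₁ * 2 ^ d * κ * r ^ d := by
    intro r hr
    have hr1 : 1 ≤ r := (le_max_left _ _).trans hr
    have hrT : K * Real.sqrt T ≤ r := (le_max_right _ _).trans hr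
    have hr0 : 0 < r := by linarith
    obtain ⟨η, hη, hη1, hη0, hηle, hηg⟩ := hcut r hr0
    have hcac := caccioppoli hα hαβ hA isOpen_univ hloc hGloc hφ.memH1Loc.2
      (T := T) (ξ := ξ) (fun ψ hψ => by rw [Measure.restrict_univ]; exact hφ.equation ψ hψ)
      (hη.mono (Set.subset_univ _))
    rw [Measure.restrict_univ] at hcac
    have hrT2 : C₁ * (M / r) ^ 2 ≤ (2 ^ d)⁻¹ / 2 * T⁻¹ := by
      have h1 : K ^ 2 * T ≤ r ^ 2 := by
        have := pow_le_pow_left₀ (by positivity) hrT 2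
        rwa [mul_pow, Real.sq_sqrt hT.le] at this
      rw [hK2] at h1
      rw [div_pow, ← mul_div_assoc, div_le_iff₀ (by positivity)]
      calc C₁ * M ^ 2 = (2 ^ d)⁻¹ / 2 * T⁻¹ * (C₁ * M ^ 2 * (2 * 2 ^ d) * T) := by field_simp
        _ ≤ _ := by gcongr
    have i1 : Integrable (fun x => (η x * φ x) ^ 2) volume :=
      (hloc.smul_continuous hη.1.continuous hη.2.1 (Set.subset_univ _)).integrable_sq
    have i2 : Integrable (fun x => (η x * ‖G x‖) ^ 2) volume :=
      (hGloc.smul_continuous hη.1.continuous hη.2.1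
        (Set.subset_univ _)).norm.integrable_sq.congr
        (Eventually.of_forall fun x => by simp [norm_smul, mul_pow])
    have i3 : IntegrableOn (fun x => (M / r) ^ 2 * φ x ^ 2) (Metric.ball 0 (2 * r)) :=
      (hball 0 (2 * r)).1.const_mul _
    have i4 : IntegrableOn (fun _ => (1 : ℝ))
        (Metric.ball (0 : EuclideanSpace ℝ (Fin d)) (2 * r)) :=
      integrableOn_const measure_ball_lt_top.ne
    have hvol : volume.real (Metric.ball (0 : EuclideanSpace ℝ (Fin d)) (2 * r)) =
        (2 * r) ^ d * κ := by
      rw [measureReal_def, Measure.addHaar_ball_of_pos volume _ (by linarith),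
        finrank_euclideanSpace_fin, ENNReal.toReal_mul, ENNReal.toReal_ofReal (by positivity)]
      rfl
    have hφe : T⁻¹ * ∫ x in Metric.ball 0 (2 * r), φ x ^ 2 ≤
        ∫ x in Metric.ball 0 (2 * r), (T⁻¹ * φ x ^ 2 + α / 2 * ‖G x‖ ^ 2) := by
      rw [← integral_const_mul]
      refine integral_mono ((hball 0 (2 * r)).1.const_mul _) (hball' 0 (2 * r)) fun x => ?_
      have : 0 ≤ α / 2 * ‖G x‖ ^ 2 := by positivity
      simpa using this
    calc ∫ x in Metric.ball 0 r, (T⁻¹ * φ x ^ 2 + α / 2 * ‖G x‖ ^ 2)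
        = ∫ x in Metric.ball 0 r, (T⁻¹ * (η x * φ x) ^ 2 + α / 2 * (η x * ‖G x‖) ^ 2) :=
          setIntegral_congr_fun Metric.isOpen_ball.measurableSet fun x hx => by simp [hη1 x hx]
      _ ≤ ∫ x, (T⁻¹ * (η x * φ x) ^ 2 + α / 2 * (η x * ‖G x‖) ^ 2) :=
          setIntegral_le_integral ((i1.const_mul _).add (i2.const_mul _))
            (Eventually.of_forall fun x => by
              simp only [Pi.zero_apply]
              positivity)
      _ ≤ C₁ * ∫ x, ((φ x * ‖gradient η x‖) ^ 2 + (η x * ‖ξ‖) ^ 2) := hcac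
      _ = C₁ * ∫ x in Metric.ball 0 (2 * r), ((φ x * ‖gradient η x‖) ^ 2 + (η x * ‖ξ‖) ^ 2) := by
          rw [setIntegral_eq_integral_of_forall_compl_eq_zero]
          intro x hx
          simp [hη.eq_zero hx, hη.gradient_eq_zero hx]
      _ ≤ C₁ * ∫ x in Metric.ball 0 (2 * r), ((M / r) ^ 2 * φ x ^ 2 + 1) := by
          refine mul_le_mul_of_nonneg_left (integral_mono_of_nonneg
            (Eventually.of_forall fun x => by simp only [Pi.zero_apply]; positivity)
            (i3.add i4) (Eventually.of_forall fun x => ?_)) hC₁pos.le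
          have h1 : ‖gradient η x‖ ^ 2 ≤ (M / r) ^ 2 :=
            pow_le_pow_left₀ (norm_nonneg _) (hηg x) 2
          have h2 : η x ^ 2 ≤ 1 := pow_le_one₀ (hη0 x) (hηle x)
          simp only [hξ, mul_one, mul_pow]
          nlinarith [mul_le_mul_of_nonneg_left h1 (sq_nonneg (φ x))]
      _ = C₁ * (M / r) ^ 2 * (∫ x in Metric.ball 0 (2 * r), φ x ^ 2) +
            C₁ * 2 ^ d * κ * r ^ d := by
          rw [integral_add i3 i4, integral_const_mul, setIntegral_const, hvol, smul_eq_mul, mul_pow]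
          ring
      _ ≤ (2 ^ d)⁻¹ / 2 * T⁻¹ * (∫ x in Metric.ball 0 (2 * r), φ x ^ 2) +
            C₁ * 2 ^ d * κ * r ^ d := by
          have : 0 ≤ ∫ x in Metric.ball 0 (2 * r), φ x ^ 2 := integral_nonneg fun x => by positivity
          gcongr
      _ ≤ _ := by
          rw [mul_assoc]
          gcongr
  have hbound := le_of_doubling_contraction (d := d)
    (a := fun r => ∫ x in Metric.ball 0 r, (T⁻¹ * φ x ^ 2 + α / 2 * ‖G x‖ ^ 2))
    (C := C₁ * 2 ^ d * κ) (Λ := (T⁻¹ + α / 2) * (Λ * 2 ^ d)) (r₀ := max 1 (K * Real.sqrt T))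
    (zero_le_one.trans (le_max_left _ _)) step ?_ (max_le hr1 hrK)
  · exact hbound
  · intro r hr
    have hr1 : 1 ≤ r := (le_max_left _ _).trans hr
    calc ∫ x in Metric.ball 0 r, (T⁻¹ * φ x ^ 2 + α / 2 * ‖G x‖ ^ 2)
        ≤ ∫ x in Metric.ball 0 r, (T⁻¹ + α / 2) * (φ x ^ 2 + ‖G x‖ ^ 2) := by
          refine integral_mono (hball' 0 r) (((hball 0 r).1.add (hball 0 r).2).const_mul _)
            fun x => ?_
          have : 0 < T⁻¹ := inv_pos.2 hT
          nlinarith [sq_nonneg (φ x), sq_nonneg ‖G x‖, mul_nonneg this.le (sq_nonneg ‖G x‖),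
            mul_nonneg hα.le (sq_nonneg (φ x))]
      _ ≤ (T⁻¹ + α / 2) * (Λ * (2 * r) ^ d) := by
          rw [integral_const_mul]
          have : 0 < T⁻¹ := inv_pos.2 hT
          gcongr
          exact growth r hr1
      _ = _ := by rw [mul_pow]; ring

end Corrector

/-! ### The exponentially weighted cutoff on a cube. -/

section Cube

variable {d : ℕ}

theorem isOpen_cube (d : ℕ) (R : ℝ) : IsOpen (cube d R) := by
  have : cube d R = ⋂ i : Fin d, {x : EuclideanSpace ℝ (Fin d) | -R < x i ∧ x i < R} := by
    ext x
    simp [cube]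
  rw [this]
  refine isOpen_iInter_of_finite fun i => ?_
  have hi : Continuous fun x : EuclideanSpace ℝ (Fin d) => x i :=
    (EuclideanSpace.proj (𝕜 := ℝ) i).continuous
  exact (isOpen_lt continuous_const hi).inter (isOpen_lt hi continuous_const)

theorem cube_mono {L R : ℝ} (h : L ≤ R) : cube d L ⊆ cube d R :=
  fun _ hx i => ⟨by linarith [(hx i).1], by linarith [(hx i).2]⟩

theorem cube_subset_ball {R r : ℝ} (h : d * R < r) : cube d R ⊆ Metric.ball 0 r := by
  intro x hx
  rw [mem_ball_zero_iff]
  refine lt_of_le_of_lt ?_ h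
  have h1 : ‖x‖ ≤ ∑ i, |x i| := by
    have h2 : x = ∑ i, x i • EuclideanSpace.single i (1 : ℝ) := by
      ext j
      simp [Finset.sum_apply, Pi.single_apply]
    calc ‖x‖ = ‖∑ i, x i • EuclideanSpace.single i (1 : ℝ)‖ := by rw [← h2]
      _ ≤ ∑ i, ‖x i • EuclideanSpace.single i (1 : ℝ)‖ := norm_sum_le _ _
      _ = ∑ i, |x i| := by simp [norm_smul]
  refine h1.trans ((Finset.sum_le_sum fun i _ => (abs_lt.2 (hx i)).le).trans ?_)
  simp

/-- The function `z ↦ z exp (-1/z)` on the positive half line, extended by zero: a smooth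
approximation of the positive part. -/
noncomputable def smoothPosPart (z : ℝ) : ℝ := z * expNegInvGlue z

theorem contDiff_smoothPosPart : ContDiff ℝ ∞ smoothPosPart :=
  contDiff_id.mul expNegInvGlue.contDiff

theorem smoothPosPart_of_nonpos {z : ℝ} (hz : z ≤ 0) : smoothPosPart z = 0 := by
  simp [smoothPosPart, expNegInvGlue.zero_of_nonpos hz]

theorem smoothPosPart_nonneg (z : ℝ) : 0 ≤ smoothPosPart z := by
  rcases le_total z 0 with h | h
  · rw [smoothPosPart_of_nonpos h]
  · exact mul_nonneg h (expNegInvGlue.nonneg z)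

/-- From `exp (-1/z) ≥ 1 - 1/z`: the smoothing loses at most `1` against the positive part, which
makes the cutoff lose at most one more `D⁻¹`. -/
theorem sub_one_le_smoothPosPart (z : ℝ) : z - 1 ≤ smoothPosPart z := by
  rcases le_or_gt z 0 with h | h
  · rw [smoothPosPart_of_nonpos h]
    linarith
  · rw [smoothPosPart, expNegInvGlue, if_neg h.not_ge]
    have h1 := Real.add_one_le_exp (-z⁻¹)
    calc z - 1 = z * (-z⁻¹ + 1) := by field_simp; ring
      _ ≤ _ := by gcongr

/-- For `z > 0` the derivative is `(1 + 1/z) exp (-1/z) ≤ 1`, for `z < 0` it vanishes, and `0`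
follows by continuity. The constant `2` has slack. -/
theorem abs_deriv_smoothPosPart_le (z : ℝ) : |deriv smoothPosPart z| ≤ 2 := by
  have hzero : ∀ z < 0, deriv smoothPosPart z = 0 := by
    intro z hz
    have : smoothPosPart =ᶠ[𝓝 z] fun _ => 0 := by
      filter_upwards [gt_mem_nhds hz] with y hy
      exact smoothPosPart_of_nonpos (le_of_lt hy)
    rw [this.deriv_eq, deriv_const]
  have hpos : ∀ z > 0, |deriv smoothPosPart z| ≤ 2 := by
    intro z hz
    have h1 : smoothPosPart =ᶠ[𝓝 z] fun y => y * Real.exp (-y⁻¹) := by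
      filter_upwards [lt_mem_nhds hz] with y hy
      rw [smoothPosPart, expNegInvGlue, if_neg (not_le.2 hy)]
    have h2 : HasDerivAt (fun y => y * Real.exp (-y⁻¹))
        (1 * Real.exp (-z⁻¹) + z * (Real.exp (-z⁻¹) * (-(-(z ^ 2)⁻¹)))) z :=
      (hasDerivAt_id z).mul ((hasDerivAt_inv hz.ne').neg.exp)
    rw [h1.deriv_eq, h2.deriv]
    have h3 : 1 * Real.exp (-z⁻¹) + z * (Real.exp (-z⁻¹) * (-(-(z ^ 2)⁻¹))) =
        (1 + z⁻¹) * Real.exp (-z⁻¹) := by field_simp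
    have h4 : 0 < z⁻¹ := inv_pos.2 hz
    have h5 : (1 + z⁻¹) * Real.exp (-z⁻¹) ≤ 1 := by
      have := Real.add_one_le_exp z⁻¹
      rw [Real.exp_neg, ← div_eq_mul_inv, div_le_one (Real.exp_pos _)]
      linarith
    rw [h3, abs_of_nonneg (by positivity)]
    linarith
  rcases lt_trichotomy z 0 with h | h | h
  · simp [hzero z h]
  · subst h
    have hc : Continuous (deriv smoothPosPart) := contDiff_smoothPosPart.continuous_deriv (by simp)
    have h1 : Tendsto (fun z => |deriv smoothPosPart z|) (𝓝[>] 0) (𝓝 |deriv smoothPosPart 0|) :=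
      (hc.abs.tendsto 0).mono_left nhdsWithin_le_nhds
    exact le_of_tendsto h1 (eventually_mem_nhdsWithin.mono hpos)
  · exact hpos z h

/-- A smooth substitute for `exp (μ max |x i|)`. -/
noncomputable def coshSum (d : ℕ) (μ : ℝ) (x : EuclideanSpace ℝ (Fin d)) : ℝ :=
  ∑ i, Real.cosh (μ * x i)

theorem contDiff_coshSum (d : ℕ) (μ : ℝ) : ContDiff ℝ ∞ (coshSum d μ) := by
  refine ContDiff.sum fun i _ => Real.contDiff_cosh.comp (contDiff_const.mul ?_)
  exact (EuclideanSpace.proj (𝕜 := ℝ) i).contDiff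

theorem coshSum_pos (hd : 0 < d) (μ : ℝ) (x : EuclideanSpace ℝ (Fin d)) : 0 < coshSum d μ x := by
  have : Nonempty (Fin d) := ⟨⟨0, hd⟩⟩
  exact Finset.sum_pos (fun i _ => Real.cosh_pos _) Finset.univ_nonempty

theorem abs_sinh_le_cosh (x : ℝ) : |Real.sinh x| ≤ Real.cosh x := by
  refine abs_le_of_sq_le_sq ?_ (Real.cosh_pos x).le
  nlinarith [Real.cosh_sq x]

/-- Termwise `|sinh| ≤ cosh`. The logarithmic gradient is thus at most `μ`, which is what makes this
an exponential weight of rate `μ`. -/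
theorem norm_gradient_coshSum_le {μ : ℝ} (hμ : 0 ≤ μ) (x : EuclideanSpace ℝ (Fin d)) :
    ‖fderiv ℝ (coshSum d μ) x‖ ≤ μ * coshSum d μ x := by
  have h : HasFDerivAt (coshSum d μ) (∑ i, Real.sinh (μ * x i) •
      (μ • (EuclideanSpace.proj i : EuclideanSpace ℝ (Fin d) →L[ℝ] ℝ))) x := by
    refine HasFDerivAt.fun_sum fun i _ => ?_
    have h1 : HasFDerivAt (fun x : EuclideanSpace ℝ (Fin d) => μ * x i)
        (μ • (EuclideanSpace.proj i : EuclideanSpace ℝ (Fin d) →L[ℝ] ℝ)) x :=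
      ((EuclideanSpace.proj (𝕜 := ℝ) i).hasFDerivAt (x := x)).const_mul μ
    exact (Real.hasDerivAt_cosh _).comp_hasFDerivAt x h1
  rw [h.fderiv, coshSum, Finset.mul_sum]
  refine (norm_sum_le _ _).trans (Finset.sum_le_sum fun i _ => ?_)
  rw [norm_smul, norm_smul, Real.norm_eq_abs, Real.norm_eq_abs, abs_of_nonneg hμ]
  have h1 : ‖(EuclideanSpace.proj i : EuclideanSpace ℝ (Fin d) →L[ℝ] ℝ)‖ ≤ 1 :=
    ContinuousLinearMap.opNorm_le_bound _ zero_le_one fun y => by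
      simpa using PiLp.norm_apply_le y i
  calc |Real.sinh (μ * x i)| * (μ * ‖(EuclideanSpace.proj i : EuclideanSpace ℝ (Fin d) →L[ℝ] ℝ)‖)
      ≤ Real.cosh (μ * x i) * (μ * 1) := by
        gcongr
        exact abs_sinh_le_cosh _
    _ = _ := by ring

/-- An exponentially weighted cutoff on a cube: its gradient is controlled by `μ` times the
function itself, up to an error which is exponentially small in the size of the cube. -/
theorem exists_cube_cutoff (hd : 2 ≤ d) {μ R : ℝ} (hμ : 0 < μ) (hR : 0 < R) :
    ∃ η : EuclideanSpace ℝ (Fin d) → ℝ, IsTestFunction (cube d R) η ∧ (∀ x, 0 ≤ η x) ∧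
      (∀ x, ‖gradient η x‖ ≤ 2 * μ * (η x + 2 * (Real.cosh (μ * R))⁻¹)) ∧
      ∀ L x, x ∈ cube d L →
        (d * Real.cosh (μ * L))⁻¹ - 2 * (Real.cosh (μ * R))⁻¹ ≤ η x := by
  set D := Real.cosh (μ * R) with hD
  have hD0 : 0 < D := Real.cosh_pos _
  have hN := coshSum_pos (d := d) (by omega) μ
  -- Here `d ≥ 2` matters: a second coordinate contributes a positive `cosh`, so the closed sublevel
  -- set lies strictly inside the open cube.
  have hsub : {x | coshSum d μ x ≤ D} ⊆ cube d R := by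
    intro x hx i
    have : Nontrivial (Fin d) := Fin.nontrivial_iff_two_le.2 hd
    obtain ⟨j, hj⟩ := exists_ne i
    have h1 : Real.cosh (μ * x i) + Real.cosh (μ * x j) ≤ coshSum d μ x := by
      rw [← Finset.sum_pair (f := fun i => Real.cosh (μ * x i)) hj.symm]
      exact Finset.sum_le_univ_sum_of_nonneg fun i => (Real.cosh_pos _).le
    have h2 : Real.cosh (μ * x i) < Real.cosh (μ * R) := by
      have : coshSum d μ x ≤ D := hx
      linarith [Real.cosh_pos (μ * x j)]
    rw [Real.cosh_lt_cosh, abs_mul, abs_mul, abs_of_pos hμ, abs_of_pos hR] at h2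
    exact abs_lt.1 (lt_of_mul_lt_mul_left h2 hμ.le)
  have hclosed : IsClosed {x | coshSum d μ x ≤ D} :=
    isClosed_le (contDiff_coshSum d μ).continuous continuous_const
  have hcompact : IsCompact {x | coshSum d μ x ≤ D} := by
    refine Metric.isCompact_of_isClosed_isBounded hclosed
      ((Metric.isBounded_ball (x := 0) (r := d * R + 1)).subset ?_)
    exact hsub.trans (cube_subset_ball (by linarith))
  -- Positive exactly where `coshSum d μ x < D`; the cutoff `D⁻¹ * smoothPosPart (q x)` is a smooth
  -- version of the positive part of `1 / coshSum - 1 / D`.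
  set q : EuclideanSpace ℝ (Fin d) → ℝ := fun x => D * (coshSum d μ x)⁻¹ - 1 with hq
  have hqsm : ContDiff ℝ ∞ q :=
    (contDiff_const.mul ((contDiff_coshSum d μ).inv fun x => (hN x).ne')).sub contDiff_const
  have hηsm : ContDiff ℝ ∞ fun x => D⁻¹ * smoothPosPart (q x) :=
    contDiff_const.mul (contDiff_smoothPosPart.comp hqsm)
  have hsupp : tsupport (fun x => D⁻¹ * smoothPosPart (q x)) ⊆ {x | coshSum d μ x ≤ D} := by
    refine closure_minimal (fun x hx => ?_) hclosed
    by_contra h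
    apply hx
    have h1 : D < coshSum d μ x := not_le.1 h
    have h2 : q x ≤ 0 := by
      rw [hq, sub_nonpos, ← div_eq_mul_inv, div_le_one (hN x)]
      exact h1.le
    simp [smoothPosPart_of_nonpos h2]
  have hPge : ∀ x, D * (coshSum d μ x)⁻¹ - 2 ≤ smoothPosPart (q x) := fun x => by
    have := sub_one_le_smoothPosPart (q x)
    simp only [hq] at this ⊢
    linarith
  have hge : ∀ x, (coshSum d μ x)⁻¹ - 2 * D⁻¹ ≤ D⁻¹ * smoothPosPart (q x) := fun x => by
    calc (coshSum d μ x)⁻¹ - 2 * D⁻¹ = D⁻¹ * (D * (coshSum d μ x)⁻¹ - 2) := by field_simp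
      _ ≤ _ := mul_le_mul_of_nonneg_left (hPge x) (inv_nonneg.2 hD0.le)
  refine ⟨fun x => D⁻¹ * smoothPosPart (q x), ⟨hηsm,
    hcompact.of_isClosed_subset (isClosed_tsupport _) hsupp, hsupp.trans hsub⟩,
    fun x => mul_nonneg (inv_nonneg.2 hD0.le) (smoothPosPart_nonneg _), fun x => ?_, ?_⟩
  · have h1 : HasFDerivAt q (D • (-(coshSum d μ x ^ 2)⁻¹ • fderiv ℝ (coshSum d μ) x)) x := by
      have h2 : HasFDerivAt (fun x => (coshSum d μ x)⁻¹)
          (-(coshSum d μ x ^ 2)⁻¹ • fderiv ℝ (coshSum d μ) x) x :=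
        (hasDerivAt_inv (hN x).ne').comp_hasFDerivAt x
          (((contDiff_coshSum d μ).differentiable (by simp)).differentiableAt.hasFDerivAt)
      exact (h2.const_mul D).sub_const 1
    have h3 : HasFDerivAt (fun x => D⁻¹ * smoothPosPart (q x)) (D⁻¹ • (deriv smoothPosPart (q x) •
        (D • (-(coshSum d μ x ^ 2)⁻¹ • fderiv ℝ (coshSum d μ) x)))) x :=
      (((contDiff_smoothPosPart.differentiable (by simp)).differentiableAt.hasDerivAt
        (x := q x)).comp_hasFDerivAt x h1).const_mul D⁻¹
    rw [gradient, LinearIsometryEquiv.norm_map, h3.fderiv]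
    simp only [norm_smul, norm_neg, norm_inv, norm_pow, Real.norm_eq_abs, abs_of_pos hD0,
      abs_of_pos (hN x)]
    calc D⁻¹ * (|deriv smoothPosPart (q x)| *
          (D * ((coshSum d μ x ^ 2)⁻¹ * ‖fderiv ℝ (coshSum d μ) x‖)))
        ≤ D⁻¹ * (2 * (D * ((coshSum d μ x ^ 2)⁻¹ * (μ * coshSum d μ x)))) := by
          have := (hN x).le
          gcongr
          · exact abs_deriv_smoothPosPart_le _
          · exact norm_gradient_coshSum_le hμ.le x
      _ = 2 * μ * (coshSum d μ x)⁻¹ := by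
          have := (hN x).ne'
          field_simp
      _ ≤ _ := by
          gcongr
          linarith [hge x]
  · intro L x hx
    refine le_trans ?_ (hge x)
    gcongr
    · exact hN x
    · calc coshSum d μ x ≤ ∑ _i : Fin d, Real.cosh (μ * L) := by
            refine Finset.sum_le_sum fun i _ => Real.cosh_le_cosh.2 ?_
            rw [abs_mul, abs_mul]
            exact mul_le_mul_of_nonneg_left ((abs_lt.2 (hx i)).le.trans (le_abs_self L))
              (abs_nonneg μ)
        _ = d * Real.cosh (μ * L) := by simp

end Cube

/-! ### Energy of the Dirichlet corrector and exponential decay. -/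

section Decay

variable {d : ℕ} {α β : ℝ}

theorem HasWeakGradient.mono {U V : Set (EuclideanSpace ℝ (Fin d))} (hVU : V ⊆ U)
    {u : EuclideanSpace ℝ (Fin d) → ℝ} {G : EuclideanSpace ℝ (Fin d) → EuclideanSpace ℝ (Fin d)}
    (h : HasWeakGradient U u G) : HasWeakGradient V u G := by
  refine ⟨h.1.mono_set hVU, h.2.1.mono_set hVU, fun ψ hψ i => ?_⟩
  have := h.2.2 ψ (hψ.mono hVU) i
  rw [setIntegral_eq_integral_of_forall_compl_eq_zero
      (fun x hx => by simp [(hψ.mono hVU).gradient_eq_zero hx]),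
    setIntegral_eq_integral_of_forall_compl_eq_zero
      (fun x hx => by simp [(hψ.mono hVU).eq_zero hx])] at this
  rw [setIntegral_eq_integral_of_forall_compl_eq_zero
      (fun x hx => by simp [hψ.gradient_eq_zero hx]),
    setIntegral_eq_integral_of_forall_compl_eq_zero
      (fun x hx => by simp [hψ.eq_zero hx]), this]

theorem HasWeakGradient.sub {U : Set (EuclideanSpace ℝ (Fin d))}
    {u v : EuclideanSpace ℝ (Fin d) → ℝ}
    {G H : EuclideanSpace ℝ (Fin d) → EuclideanSpace ℝ (Fin d)}
    (hu : MemL2Loc U u) (hG : MemL2Loc U G) (hv : MemL2Loc U v) (hH : MemL2Loc U H)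
    (h : HasWeakGradient U u G) (h' : HasWeakGradient U v H) :
    HasWeakGradient U (fun x => u x - v x) (fun x => G x - H x) := by
  refine ⟨h.1.sub h'.1, h.2.1.sub h'.2.1, fun ψ hψ i => ?_⟩
  have i1 := (hu.integrable_mul_gradient_apply hψ i).restrict (s := U)
  have i2 := (hv.integrable_mul_gradient_apply hψ i).restrict (s := U)
  have i3 := ((hG.apply i).integrable_mul_continuous hψ.1.continuous hψ.2.1
    hψ.2.2).restrict (s := U)
  have i4 := ((hH.apply i).integrable_mul_continuous hψ.1.continuous hψ.2.1
    hψ.2.2).restrict (s := U)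
  simp only [PiLp.sub_apply, sub_mul]
  rw [integral_sub i1 i2, integral_sub i3 i4, h.2.2 ψ hψ i, h'.2.2 ψ hψ i]
  ring

/-- The constant sequence is an approximation, and classical integration by parts gives the weak
gradient. This makes smooth test functions admissible in the Dirichlet problem. -/
theorem IsTestFunction.memH10 {U : Set (EuclideanSpace ℝ (Fin d))}
    {ψ : EuclideanSpace ℝ (Fin d) → ℝ} (hψ : IsTestFunction U ψ) :
    MemH10 U ψ (gradient ψ) := by
  have hg := continuous_gradient hψ.1
  refine ⟨⟨(hψ.1.continuous.memLp_of_hasCompactSupport hψ.2.1).restrict _,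
    (hg.memLp_of_hasCompactSupport hψ.hasCompactSupport_gradient).restrict _,
    hψ.1.continuous.locallyIntegrable.locallyIntegrableOn _,
    hg.locallyIntegrable.locallyIntegrableOn _, fun χ hχ i => ?_⟩,
    fun _ => ψ, fun _ => hψ, by simp, by simp⟩
  rw [setIntegral_eq_integral_of_forall_compl_eq_zero
      (fun x hx => by simp [hχ.gradient_eq_zero hx]),
    setIntegral_eq_integral_of_forall_compl_eq_zero
      (fun x hx => by simp [hχ.eq_zero hx])]
  simp only [gradient_apply_eq]
  have hloc : ∀ {θ : EuclideanSpace ℝ (Fin d) → ℝ}, ContDiff ℝ ∞ θ → MemL2Loc Set.univ θ := by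
    intro θ hθ K hK _
    have : IsFiniteMeasure (volume.restrict K) := ⟨by simpa using hK.measure_lt_top⟩
    obtain ⟨C, hC⟩ := hK.exists_bound_of_continuousOn hθ.continuous.continuousOn
    exact MemLp.of_bound hθ.continuous.aestronglyMeasurable C
      ((ae_restrict_mem hK.measurableSet).mono hC)
  refine integral_mul_fderiv_eq_neg_fderiv_mul_of_integrable ?_ ?_ ?_
    (fun x _ => hψ.differentiableAt x) (fun x _ => hχ.differentiableAt x)
  · simp only [← gradient_apply_eq]
    have := (hloc hχ.1).integrable_mul_gradient_apply (hψ.mono (Set.subset_univ _)) i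
    simpa only [mul_comm] using this
  · simp only [← gradient_apply_eq]
    exact (hloc hψ.1).integrable_mul_gradient_apply (hχ.mono (Set.subset_univ _)) i
  · exact (hloc hψ.1).integrable_mul_continuous hχ.1.continuous hχ.2.1 (Set.subset_univ _)

/-- The energy of the Dirichlet corrector is controlled by the volume of the domain. -/
theorem IsDirichletCorrector.energy_le (hα : 0 < α) (hαβ : α ≤ β)
    {A : EuclideanSpace ℝ (Fin d) → Matrix (Fin d) (Fin d) ℝ} (hA : IsCoefficientField α β A)
    {ξ : EuclideanSpace ℝ (Fin d)} (hξ : ‖ξ‖ = 1) {T R : ℝ}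
    {φ : EuclideanSpace ℝ (Fin d) → ℝ} {G : EuclideanSpace ℝ (Fin d) → EuclideanSpace ℝ (Fin d)}
    (h : IsDirichletCorrector A ξ T R φ G) (hfin : volume (cube d R) ≠ ⊤) :
    ∫ x in cube d R, (T⁻¹ * φ x ^ 2 + α / 2 * ‖G x‖ ^ 2) ≤
      (8 * β ^ 2 / α + β) * volume.real (cube d R) := by
  have heq := h.equation φ G h.memH10
  have hφ : MemLp φ 2 (volume.restrict (cube d R)) := h.memH10.1.1
  have hG : MemLp G 2 (volume.restrict (cube d R)) := h.memH10.1.2.1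
  have : IsFiniteMeasure (volume.restrict (cube d R)) := ⟨by simpa using hfin.lt_top⟩
  have i1 : IntegrableOn (fun x => T⁻¹ * φ x * φ x +
      inner ℝ (G x) (Matrix.toEuclideanLin (A x) (ξ + G x))) (cube d R) :=
    ((hφ.integrable_sq.const_mul T⁻¹).congr (Eventually.of_forall fun x => by ring)).add
      (integrable_inner_of_memLp hG (hA.memLp_flux ((memLp_const ξ).add hG)))
  have i2 : IntegrableOn (fun x => T⁻¹ * φ x ^ 2 + α / 2 * ‖G x‖ ^ 2) (cube d R) :=
    (hφ.integrable_sq.const_mul _).add (hG.norm.integrable_sq.const_mul _)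
  calc ∫ x in cube d R, (T⁻¹ * φ x ^ 2 + α / 2 * ‖G x‖ ^ 2)
      ≤ ∫ x in cube d R, (T⁻¹ * φ x * φ x +
          inner ℝ (G x) (Matrix.toEuclideanLin (A x) (ξ + G x)) + (8 * β ^ 2 / α + β)) := by
        refine integral_mono_ae i2 (i1.add (integrable_const _)) ?_
        filter_upwards [ae_restrict_of_ae hA.2] with x hx
        -- Cutoff `1` with gradient `0`: the corrector itself is an admissible test function.
        have := energy_le_inner_add hα hαβ hx 1 (φ x) 0 (G x) ξ
        simp only [one_mul, one_pow, one_smul, smul_zero, add_zero, norm_zero, mul_zero, hξ,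
          zero_add, mul_one, ne_eq, OfNat.ofNat_ne_zero, not_false_eq_true, zero_pow] at this
        linarith
    _ = _ := by
        rw [integral_add i1 (integrable_const _), heq, zero_add, setIntegral_const, smul_eq_mul,
          mul_comm]

/-- Exponential decay, away from the boundary of a cube, of the energy of solutions of the
homogeneous massive equation. -/
theorem setIntegral_cube_norm_sq_le_exp (hd : 2 ≤ d) (hα : 0 < α) (hαβ : α ≤ β)
    {A : EuclideanSpace ℝ (Fin d) → Matrix (Fin d) (Fin d) ℝ} (hA : IsCoefficientField α β A)
    {T R L μ B : ℝ} (hT : 0 < T) (hL : 0 < L) (hLR : L ≤ R) (hμ : 0 < μ)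
    (hμT : (8 * β ^ 2 / α + β) * (8 * μ ^ 2) = T⁻¹)
    {w : EuclideanSpace ℝ (Fin d) → ℝ} {g : EuclideanSpace ℝ (Fin d) → EuclideanSpace ℝ (Fin d)}
    (hw : MemH1 (cube d R) w g)
    (heq : ∀ ψ, IsTestFunction (cube d R) ψ → ∫ x in cube d R, (T⁻¹ * ψ x * w x +
      inner ℝ (gradient ψ x) (Matrix.toEuclideanLin (A x) (g x))) = 0)
    (hB : ∫ x in cube d R, (T⁻¹ * w x ^ 2 + α / 2 * ‖g x‖ ^ 2) ≤ B) :
    ∫ x in cube d L, ‖g x‖ ^ 2 ≤ 128 * d ^ 2 / α * B * Real.exp (-(2 * μ * (R - L))) := by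
  have hβ : 0 < β := hα.trans_le hαβ
  set C₁ := 8 * β ^ 2 / α + β with hC₁
  have hC₁pos : 0 < C₁ := by positivity
  have hTi : 0 < T⁻¹ := inv_pos.2 hT
  have hd0 : (0 : ℝ) < d := by exact_mod_cast (by omega : 0 < d)
  set p := Real.cosh (μ * L) with hp
  set D := Real.cosh (μ * R) with hD
  have hp0 : 0 < p := Real.cosh_pos _
  have hD0 : 0 < D := Real.cosh_pos _
  set e := Real.exp (-(μ * (R - L))) with he
  have he0 : 0 < e := Real.exp_pos _
  have he2 : Real.exp (-(2 * μ * (R - L))) = e ^ 2 := by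
    rw [he, ← Real.exp_nat_mul]
    congr 1
    push_cast
    ring
  have hpD : p ≤ 2 * e * D := by
    have h1 : p ≤ Real.exp (μ * L) := by
      rw [hp, Real.cosh_eq]
      have : Real.exp (-(μ * L)) ≤ Real.exp (μ * L) := by
        apply Real.exp_le_exp.2
        nlinarith [mul_pos hμ hL]
      linarith
    have h2 : Real.exp (μ * R) ≤ 2 * D := by
      rw [hD, Real.cosh_eq]
      linarith [Real.exp_pos (-(μ * R))]
    calc p ≤ Real.exp (μ * L) := h1
      _ = e * Real.exp (μ * R) := by
        rw [he, ← Real.exp_add]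
        congr 1
        ring
      _ ≤ e * (2 * D) := by gcongr
      _ = _ := by ring
  have i1 : IntegrableOn (fun x => w x ^ 2) (cube d R) := hw.1.integrable_sq
  have i2 : IntegrableOn (fun x => ‖g x‖ ^ 2) (cube d R) := hw.2.1.norm.integrable_sq
  have hsum : T⁻¹ * (∫ x in cube d R, w x ^ 2) + α / 2 * (∫ x in cube d R, ‖g x‖ ^ 2) ≤ B := by
    rwa [← integral_const_mul, ← integral_const_mul,
      ← integral_add (i1.const_mul _) (i2.const_mul _)]
  have hw0 : 0 ≤ T⁻¹ * ∫ x in cube d R, w x ^ 2 :=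
    mul_nonneg hTi.le (integral_nonneg fun x => by positivity)
  have hg0 : 0 ≤ α / 2 * ∫ x in cube d R, ‖g x‖ ^ 2 :=
    mul_nonneg (by positivity) (integral_nonneg fun x => by positivity)
  have hB0 : 0 ≤ B := by linarith
  have hgLR : ∫ x in cube d L, ‖g x‖ ^ 2 ≤ ∫ x in cube d R, ‖g x‖ ^ 2 :=
    setIntegral_mono_set i2 (Eventually.of_forall fun x => by simp only [Pi.zero_apply]; positivity)
      (cube_mono hLR).eventuallyLE
  rw [he2]
  -- Only in this case is the lower bound for `η` on `Q_L` sure to be useful. Otherwise `R - L` is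
  -- at most of order `1 / μ`, the exponential is bounded below, and the total energy bound
  -- suffices. Both cases yield `128 d²`.
  by_cases hcase : 4 * d * p ≤ D
  · obtain ⟨η, hη, hη0, hηg, hηL⟩ := exists_cube_cutoff hd hμ (hL.trans_le hLR)
    have hcac := caccioppoli hα hαβ hA (isOpen_cube d R) (memL2Loc_of_memLp hw.1)
      (memL2Loc_of_memLp hw.2.1) hw.2.2 (T := T) (ξ := 0) (by simpa only [zero_add] using heq) hη
    have i3 : IntegrableOn (fun x => (η x * w x) ^ 2) (cube d R) :=
      ((memL2Loc_of_memLp hw.1).smul_continuous hη.1.continuous hη.2.1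
        hη.2.2).integrable_sq.integrableOn
    have i4 : IntegrableOn (fun x => (η x * ‖g x‖) ^ 2) (cube d R) :=
      (((memL2Loc_of_memLp hw.2.1).smul_continuous hη.1.continuous hη.2.1
        hη.2.2).norm.integrable_sq.congr
        (Eventually.of_forall fun x => by simp [norm_smul, mul_pow])).integrableOn
    have hright : ∫ x in cube d R, ((w x * ‖gradient η x‖) ^ 2 + (η x * ‖(0 :
        EuclideanSpace ℝ (Fin d))‖) ^ 2) ≤ 8 * μ ^ 2 * (∫ x in cube d R, (η x * w x) ^ 2) +
          32 * μ ^ 2 * D⁻¹ ^ 2 * ∫ x in cube d R, w x ^ 2 := by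
      rw [← integral_const_mul, ← integral_const_mul,
        ← integral_add (i3.const_mul _) (i1.const_mul _)]
      refine integral_mono_of_nonneg
        (Eventually.of_forall fun x => by simp only [Pi.zero_apply]; positivity)
        ((i3.const_mul _).add (i1.const_mul _)) (Eventually.of_forall fun x => ?_)
      have h1 : ‖gradient η x‖ ^ 2 ≤ (2 * μ * (η x + 2 * D⁻¹)) ^ 2 :=
        pow_le_pow_left₀ (norm_nonneg _) (hηg x) 2
      have h2 : (2 * μ * (η x + 2 * D⁻¹)) ^ 2 ≤ 8 * μ ^ 2 * η x ^ 2 + 32 * μ ^ 2 * D⁻¹ ^ 2 := by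
        nlinarith [mul_nonneg (sq_nonneg μ) (sq_nonneg (η x - 2 * D⁻¹))]
      simp only [norm_zero, mul_zero, mul_pow, ne_eq, OfNat.ofNat_ne_zero, not_false_eq_true,
        zero_pow, add_zero] at *
      nlinarith [mul_le_mul_of_nonneg_left (h1.trans h2) (sq_nonneg (w x))]
    rw [integral_add (i3.const_mul _) (i4.const_mul _), integral_const_mul,
      integral_const_mul] at hcac
    -- By `hμT` the term with `η w` equals the mass term on the left of `hcac` and cancels; the
    -- remainder has coefficient `C₁ * 32 μ² = 4 T⁻¹`.
    have hweighted : α / 2 * (∫ x in cube d R, (η x * ‖g x‖) ^ 2) ≤ 4 * D⁻¹ ^ 2 * B := by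
      have h1 := mul_le_mul_of_nonneg_left hright hC₁pos.le
      have h2 : C₁ * (8 * μ ^ 2 * (∫ x in cube d R, (η x * w x) ^ 2) +
          32 * μ ^ 2 * D⁻¹ ^ 2 * ∫ x in cube d R, w x ^ 2) =
          T⁻¹ * (∫ x in cube d R, (η x * w x) ^ 2) +
          4 * D⁻¹ ^ 2 * (T⁻¹ * ∫ x in cube d R, w x ^ 2) := by
        rw [← hμT]
        ring
      have h3 : 4 * D⁻¹ ^ 2 * (T⁻¹ * ∫ x in cube d R, w x ^ 2) ≤ 4 * D⁻¹ ^ 2 * B := by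
        gcongr
        linarith
      linarith
    have hlow : ∀ x ∈ cube d L, (2 * d * p)⁻¹ ≤ η x := by
      intro x hx
      refine le_trans ?_ (hηL L x hx)
      have h1 : D⁻¹ ≤ (4 * d * p)⁻¹ := by gcongr
      have h2 : (d * p)⁻¹ - 2 * (4 * d * p)⁻¹ = (2 * d * p)⁻¹ := by
        field_simp
        norm_num
      linarith
    have hL2 : (2 * d * p)⁻¹ ^ 2 * (∫ x in cube d L, ‖g x‖ ^ 2) ≤
        ∫ x in cube d R, (η x * ‖g x‖) ^ 2 := by
      rw [← integral_const_mul]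
      refine (setIntegral_mono_on ((i2.mono_set (cube_mono hLR)).const_mul _)
        (i4.mono_set (cube_mono hLR)) (isOpen_cube d L).measurableSet fun x hx => ?_).trans
        (setIntegral_mono_set i4 (Eventually.of_forall fun x => by
          simp only [Pi.zero_apply]; positivity) (cube_mono hLR).eventuallyLE)
      rw [mul_pow]
      have := hlow x hx
      gcongr
    have h1 : (∫ x in cube d L, ‖g x‖ ^ 2) ≤ (2 * d * p) ^ 2 * (8 * D⁻¹ ^ 2 * B / α) := by
      have h2 : ∫ x in cube d R, (η x * ‖g x‖) ^ 2 ≤ 8 * D⁻¹ ^ 2 * B / α := by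
        rw [le_div_iff₀ hα]
        linarith
      have h3 := hL2.trans h2
      rwa [inv_pow, inv_mul_le_iff₀ (by positivity)] at h3
    refine h1.trans ?_
    have h4 : (p * D⁻¹) ^ 2 ≤ (2 * e) ^ 2 := by
      refine pow_le_pow_left₀ (by positivity) ?_ 2
      rw [← div_eq_mul_inv, div_le_iff₀ hD0]
      exact hpD
    calc (2 * d * p) ^ 2 * (8 * D⁻¹ ^ 2 * B / α) = 32 * d ^ 2 / α * B * (p * D⁻¹) ^ 2 := by ring
      _ ≤ 32 * d ^ 2 / α * B * (2 * e) ^ 2 := by gcongr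
      _ = _ := by ring
  · have h1 : 1 ≤ 8 * d * e := by
      have : D < 4 * d * (2 * e * D) := (not_le.1 hcase).trans_le (by gcongr)
      by_contra h
      nlinarith [mul_lt_mul_of_pos_right (not_le.1 h) hD0]
    have h2 : 1 ≤ (8 * d * e) ^ 2 := one_le_pow₀ h1
    have h3 : ∫ x in cube d R, ‖g x‖ ^ 2 ≤ 2 * B / α := by
      rw [le_div_iff₀ hα]
      linarith
    calc ∫ x in cube d L, ‖g x‖ ^ 2 ≤ 2 * B / α * 1 := by linarith
      _ ≤ 2 * B / α * (8 * d * e) ^ 2 := by gcongr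
      _ = _ := by ring

end Decay

/-! ### The difference of the correctors and the choice of constants. -/

section Main

variable {d : ℕ} {α β : ℝ}

/-- The common source `A ξ` cancels by linearity, each of the two integrals being finite separately.
-/
theorem IsDirichletCorrector.sub_equation
    {A : EuclideanSpace ℝ (Fin d) → Matrix (Fin d) (Fin d) ℝ} (hA : IsCoefficientField α β A)
    {ξ : EuclideanSpace ℝ (Fin d)} {T R : ℝ} {φ φR : EuclideanSpace ℝ (Fin d) → ℝ}
    {G GR : EuclideanSpace ℝ (Fin d) → EuclideanSpace ℝ (Fin d)}
    (h : IsDirichletCorrector A ξ T R φR GR) (h' : IsRegularizedCorrector A ξ T φ G)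
    {ψ : EuclideanSpace ℝ (Fin d) → ℝ} (hψ : IsTestFunction (cube d R) ψ) :
    ∫ x in cube d R, (T⁻¹ * ψ x * (φR x - φ x) +
      inner ℝ (gradient ψ x) (Matrix.toEuclideanLin (A x) (GR x - G x))) = 0 := by
  have e1 := h.equation ψ _ hψ.memH10
  have e2 := h'.equation ψ (hψ.mono (Set.subset_univ _))
  rw [← setIntegral_eq_integral_of_forall_compl_eq_zero (s := cube d R)
    (fun x hx => by simp [hψ.eq_zero hx, hψ.gradient_eq_zero hx])] at e2
  have key : ∀ {v : EuclideanSpace ℝ (Fin d) → ℝ}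
      {V : EuclideanSpace ℝ (Fin d) → EuclideanSpace ℝ (Fin d)}, MemL2Loc (cube d R) v →
      MemL2Loc (cube d R) V → IntegrableOn (fun x => T⁻¹ * ψ x * v x +
        inner ℝ (gradient ψ x) (Matrix.toEuclideanLin (A x) (ξ + V x))) (cube d R) := by
    intro v V hv hV
    have j1 : Integrable (fun x => T⁻¹ * (v x * ψ x)) volume :=
      (hv.integrable_mul_continuous hψ.1.continuous hψ.2.1 hψ.2.2).const_mul _
    have j2 : Integrable (fun x => ∑ i, Matrix.toEuclideanLin (A x) (ξ + V x) i *
        gradient ψ x i) volume :=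
      integrable_finsetSum _ fun i _ => ((hA.memL2Loc_flux
        (memL2Loc_const_add hV ξ)).apply i).integrable_mul_gradient_apply hψ i
    refine ((j1.add j2).congr (Eventually.of_forall fun x => ?_)).integrableOn
    simp only [Pi.add_apply, inner_eq_sum_mul]
    ring
  have k1 := key (memL2Loc_of_memLp h.memH10.1.1) (memL2Loc_of_memLp h.memH10.1.2.1)
  have k2 := key (v := φ) (V := G) (fun S hS _ => (h'.memH1Loc.1 S hS).1)
    (fun S hS _ => (h'.memH1Loc.1 S hS).2)
  rw [← sub_zero (0 : ℝ)]
  nth_rewrite 1 [← e1]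
  rw [← e2, ← integral_sub k1 k2]
  refine integral_congr_ae (Eventually.of_forall fun x => ?_)
  simp only [map_add, map_sub, inner_add_right, inner_sub_right]
  ring

theorem memH1_cube_sub
    {A : EuclideanSpace ℝ (Fin d) → Matrix (Fin d) (Fin d) ℝ}
    {ξ : EuclideanSpace ℝ (Fin d)} {T R : ℝ} {φ φR : EuclideanSpace ℝ (Fin d) → ℝ}
    {G GR : EuclideanSpace ℝ (Fin d) → EuclideanSpace ℝ (Fin d)}
    (h : IsDirichletCorrector A ξ T R φR GR) (h' : IsRegularizedCorrector A ξ T φ G)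
    {r : ℝ} (hr : cube d R ⊆ Metric.ball 0 r) :
    MemH1 (cube d R) (fun x => φR x - φ x) (fun x => GR x - G x) := by
  have hsub := hr.trans Metric.ball_subset_closedBall
  have hc := h'.memH1Loc.1 _ (isCompact_closedBall (0 : EuclideanSpace ℝ (Fin d)) r)
  have hφ := hc.1.mono_measure (Measure.restrict_mono hsub le_rfl)
  have hG := hc.2.mono_measure (Measure.restrict_mono hsub le_rfl)
  have hR := h.memH10.1
  exact ⟨hR.1.sub hφ, hR.2.1.sub hG, hR.2.2.sub (memL2Loc_of_memLp hR.1)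
    (memL2Loc_of_memLp hR.2.1) (memL2Loc_of_memLp hφ) (memL2Loc_of_memLp hG)
    (h'.memH1Loc.2.mono (Set.subset_univ _))⟩

theorem energy_sub_le {T : ℝ} (hT : 0 < T) (hα : 0 < α) (a b : ℝ)
    (v w : EuclideanSpace ℝ (Fin d)) :
    T⁻¹ * (a - b) ^ 2 + α / 2 * ‖v - w‖ ^ 2 ≤
      2 * (T⁻¹ * b ^ 2 + α / 2 * ‖w‖ ^ 2) + 2 * (T⁻¹ * a ^ 2 + α / 2 * ‖v‖ ^ 2) := by
  have h1 : (a - b) ^ 2 ≤ 2 * b ^ 2 + 2 * a ^ 2 := by nlinarith [sq_nonneg (a + b)]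
  have h2 : ‖v - w‖ ^ 2 ≤ 2 * ‖w‖ ^ 2 + 2 * ‖v‖ ^ 2 := by
    nlinarith [parallelogram_law_with_norm ℝ v w, sq_nonneg ‖v + w‖]
  have h3 := mul_le_mul_of_nonneg_left h1 (inv_pos.2 hT).le
  have h4 := mul_le_mul_of_nonneg_left h2 (half_pos hα).le
  linarith

end Main

theorem theorem5 (d : ℕ) (hd : 2 ≤ d) (α β : ℝ) (hα : 0 < α) (hαβ : α ≤ β) :
    ∃ c : ℝ, 0 < c ∧
      ∀ T₀ K₁ K₂ : ℝ, 0 < T₀ → 0 < K₁ → 0 < K₂ →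
        ∃ C : ℝ, 0 < C ∧
          ∀ (A : EuclideanSpace ℝ (Fin d) → Matrix (Fin d) (Fin d) ℝ)
            (ξ : EuclideanSpace ℝ (Fin d)) (T R L : ℝ)
            (φT : EuclideanSpace ℝ (Fin d) → ℝ)
            (DφT : EuclideanSpace ℝ (Fin d) → EuclideanSpace ℝ (Fin d))
            (φTR : EuclideanSpace ℝ (Fin d) → ℝ)
            (DφTR : EuclideanSpace ℝ (Fin d) → EuclideanSpace ℝ (Fin d)),
            IsCoefficientField α β A → ‖ξ‖ = 1 → T₀ ≤ T →
            0 < L → L ≤ R → R ≤ K₁ * (R - L) → Real.sqrt T ≤ K₂ * (R - L) →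
            IsRegularizedCorrector A ξ T φT DφT →
            IsDirichletCorrector A ξ T R φTR DφTR →
            ∫ x in cube d L, ‖DφTR x - DφT x‖ ^ 2 ≤
              C * (R ^ d * T * Real.exp (-c * ((R - L) / Real.sqrt T))) := by
  obtain ⟨K, C₀, hK, hC₀, hcorr⟩ := exists_corrector_energy_bound d hα hαβ
  have hβ : 0 < β := hα.trans_le hαβ
  have hd0 : (0 : ℝ) < d := by exact_mod_cast (by omega : 0 < d)
  have hC₁pos : 0 < 8 * β ^ 2 / α + β := by positivity
  -- Normalized so that `μ = 1 / (s √T)` meets the absorption condition `hμT`; the rate `2 / s` is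
  -- then the `2μ` of the decay estimate.
  set s := Real.sqrt (8 * (8 * β ^ 2 / α + β)) with hs
  have hs0 : 0 < s := Real.sqrt_pos.2 (by positivity)
  have hs2 : s ^ 2 = 8 * (8 * β ^ 2 / α + β) := Real.sq_sqrt (by positivity)
  refine ⟨2 / s, by positivity, fun T₀ K₁ K₂ hT₀ _ hK₂ => ?_⟩
  set κ := volume.real (Metric.ball (0 : EuclideanSpace ℝ (Fin d)) 1) with hκ
  have hκ0 : 0 ≤ κ := measureReal_nonneg
  -- The ball of radius `ρ R` must contain `Q_R` (from `d + 1`) and satisfy both conditions of the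
  -- corrector bound: `ρ R ≥ K √T` (from `K * K₂`) and `ρ R ≥ 1` (from the last term, as `√T₀ ≤ √T ≤
  -- K₂ R`).
  set ρ := d + 1 + K * K₂ + K₂ / Real.sqrt T₀ with hρ
  have hsT₀ : 0 < Real.sqrt T₀ := Real.sqrt_pos.2 hT₀
  have hρ0 : 0 < ρ := by positivity
  set E := C₀ * ρ ^ d + (8 * β ^ 2 / α + β) * (ρ ^ d * κ) with hE
  have hE0 : 0 < E := by positivity
  refine ⟨128 * d ^ 2 / α * (2 * E) / T₀, by positivity, ?_⟩
  intro A ξ T R L φT DφT φTR DφTR hA hξ hT hL hLR _ hTK hφT hφTR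
  have hT0 : 0 < T := hT₀.trans_le hT
  have hsT : 0 < Real.sqrt T := Real.sqrt_pos.2 hT0
  have hR : 0 < R := hL.trans_le hLR
  have hTR : Real.sqrt T ≤ K₂ * R := hTK.trans (by gcongr; linarith)
  have hsTT : Real.sqrt T₀ ≤ Real.sqrt T := Real.sqrt_le_sqrt hT
  have hρR : ρ * R = d * R + R + K * (K₂ * R) + K₂ * R / Real.sqrt T₀ := by
    rw [hρ]
    ring
  have hq1 : 1 ≤ K₂ * R / Real.sqrt T₀ := by
    rw [le_div_iff₀ hsT₀]
    linarith
  have hq2 : K * Real.sqrt T ≤ K * (K₂ * R) := by gcongr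
  have hq3 : 0 ≤ K * Real.sqrt T := by positivity
  have hdR : 0 ≤ d * R := by positivity
  have hsub : cube d R ⊆ Metric.ball 0 (ρ * R) := cube_subset_ball (by linarith)
  have hvol : volume.real (cube d R) ≤ (ρ * R) ^ d * κ := by
    refine (measureReal_mono hsub measure_ball_lt_top.ne).trans (le_of_eq ?_)
    rw [measureReal_def, Measure.addHaar_ball_of_pos volume _ (by positivity),
      finrank_euclideanSpace_fin, ENNReal.toReal_mul, ENNReal.toReal_ofReal (by positivity)]
    rfl
  have hc := hφT.memH1Loc.1 _ (isCompact_closedBall (0 : EuclideanSpace ℝ (Fin d)) (ρ * R))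
  have iT : IntegrableOn (fun x => T⁻¹ * φT x ^ 2 + α / 2 * ‖DφT x‖ ^ 2)
      (Metric.ball 0 (ρ * R)) :=
    ((hc.1.integrable_sq.const_mul _).add (hc.2.norm.integrable_sq.const_mul _)).mono_measure
      (Measure.restrict_mono Metric.ball_subset_closedBall le_rfl)
  have iTR : IntegrableOn (fun x => T⁻¹ * φTR x ^ 2 + α / 2 * ‖DφTR x‖ ^ 2) (cube d R) :=
    (hφTR.memH10.1.1.integrable_sq.const_mul _).add
      (hφTR.memH10.1.2.1.norm.integrable_sq.const_mul _)
  have b1 : ∫ x in cube d R, (T⁻¹ * φT x ^ 2 + α / 2 * ‖DφT x‖ ^ 2) ≤ C₀ * (ρ * R) ^ d :=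
    (setIntegral_mono_set iT (Eventually.of_forall fun x => by
      simp only [Pi.zero_apply]; positivity) hsub.eventuallyLE).trans
      (hcorr A ξ T φT DφT hA hξ hT0 hφT (ρ * R) (by linarith) (by linarith))
  have b2 : ∫ x in cube d R, (T⁻¹ * φTR x ^ 2 + α / 2 * ‖DφTR x‖ ^ 2) ≤
      (8 * β ^ 2 / α + β) * ((ρ * R) ^ d * κ) :=
    (hφTR.energy_le hα hαβ hA hξ
      (ne_top_of_le_ne_top measure_ball_lt_top.ne (measure_mono hsub))).trans (by gcongr)
  have hw := memH1_cube_sub hφTR hφT hsub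
  have hB : ∫ x in cube d R, (T⁻¹ * (φTR x - φT x) ^ 2 + α / 2 * ‖DφTR x - DφT x‖ ^ 2) ≤
      2 * E * R ^ d := by
    calc ∫ x in cube d R, (T⁻¹ * (φTR x - φT x) ^ 2 + α / 2 * ‖DφTR x - DφT x‖ ^ 2)
        ≤ ∫ x in cube d R, (2 * (T⁻¹ * φT x ^ 2 + α / 2 * ‖DφT x‖ ^ 2) +
            2 * (T⁻¹ * φTR x ^ 2 + α / 2 * ‖DφTR x‖ ^ 2)) := by
          refine integral_mono ((hw.1.integrable_sq.const_mul _).add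
            (hw.2.1.norm.integrable_sq.const_mul _))
            (((iT.mono_set hsub).const_mul _).add (iTR.const_mul _)) fun x => ?_
          exact energy_sub_le hT0 hα _ _ _ _
      _ ≤ 2 * (C₀ * (ρ * R) ^ d) + 2 * ((8 * β ^ 2 / α + β) * ((ρ * R) ^ d * κ)) := by
          rw [integral_add ((iT.mono_set hsub).const_mul _) (iTR.const_mul _), integral_const_mul,
            integral_const_mul]
          gcongr
      _ = _ := by
          rw [hE, mul_pow]
          ring
  have hμT : (8 * β ^ 2 / α + β) * (8 * (s⁻¹ * (Real.sqrt T)⁻¹) ^ 2) = T⁻¹ := by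
    rw [mul_pow, inv_pow, inv_pow, Real.sq_sqrt hT0.le, hs2]
    field_simp
  have hdecay := setIntegral_cube_norm_sq_le_exp hd hα hαβ hA hT0 hL hLR
    (mul_pos (inv_pos.2 hs0) (inv_pos.2 hsT)) hμT hw
    (fun ψ hψ => hφTR.sub_equation hA hφT hψ) hB
  refine hdecay.trans ?_
  have hexp : -(2 * (s⁻¹ * (Real.sqrt T)⁻¹) * (R - L)) = -(2 / s) * ((R - L) / Real.sqrt T) := by
    field_simp
  rw [hexp]
  set e := Real.exp (-(2 / s) * ((R - L) / Real.sqrt T))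
  have he : 0 < e := Real.exp_pos _
  -- The argument gives the bound without the factor `T`; it is inserted here at the cost of `1 /
  -- T₀` in the constant.
  have h1 : 1 ≤ T / T₀ := (one_le_div hT₀).2 hT
  calc 128 * d ^ 2 / α * (2 * E * R ^ d) * e = 128 * d ^ 2 / α * (2 * E * R ^ d) * e * 1 := by ring
    _ ≤ 128 * d ^ 2 / α * (2 * E * R ^ d) * e * (T / T₀) := by gcongr
    _ = _ := by ring
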